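/- For $N\ge 0$ let $\omega_N=\frac{\sqrt{-1}}{2\pi}\,\partial\bar\partial\log\bigl(1+\|z\|^2\bigr)$ be the Fubini--Study form in the affine chart $\mathbb{C}^N\subset\mathbb{CP}^N$, $w\mapsto[1:w_1:\dots:w_N]$. A mapping $g\colon\Omega\to\mathbb{C}^N\subset\mathbb{CP}^N$ is called minimally embedded if its image is not contained in a proper projective subspace of $\mathbb{CP}^N$. Theorem. Let $\Omega\subset\mathbb{C}^n\subset\mathbb{CP}^n$ be a (nonempty) connected open set and $f\colon\Omega\to\mathbb{C}^d\subset\mathbb{CP}^d$ a minimally embedded holomorphic mapping. Then there are an integer $m$ and a minimally embedded holomorphic mapping $h\colon\Omega\to\mathbb{C}^m\subset\mathbb{CP}^m$ such that $$\omega_n+f^*\omega_d=h^*\omega_m\quad\text{on }\Omega,$$ and, if $0\in\Omega$ and $f(0)=0$, then $h$ can be chosen with $h(0)=0$. The mapping $h$ is unique in the following sense. The dimension $m$ is the same for all minimally embedded holomorphic mappings that satisfy this identity; if $h,\tilde h\colon\Omega\to\mathbb{C}^m\subset\mathbb{CP}^m$ are two of them, then there is a unitary $(m+1)\times(m+1)$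 matrix $U$ with $[1:\tilde h(z)]=U\,[1:h(z)]$ for all $z\in\Omega$; and if in addition $h$ and $\tilde h$ both vanish at a common point of $\Omega$ (for instance under the normalization $h(0)=\tilde h(0)=0$), then $\tilde h=Uh$ on $\Omega$ for some unitary $m\times m$ matrix $U$. Moreover, the dimension $m$ satisfies the following: (i) If $d\le n$, then $\displaystyle n(d+1)-\frac{d(d-1)}{2}\le m\le n(d+1)+d$. (ii) If $d\ge n$, then $\displaystyle m\ge\max\Bigl(\frac{n(n+3)}{2},\,d\Bigr)$. -/

import Mathlib

open scoped Matrix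

noncomputable section

namespace FubiniStudy

section Forms

variable {E F : Type*} [NormedAddCommGroup E] [NormedSpace ℂ E]
  [NormedAddCommGroup F] [NormedSpace ℂ F]

/-- Multiplication by `√-1` on a complex normed space, as a real-linear map. -/
def complexStructure (E : Type*) [NormedAddCommGroup E] [NormedSpace ℂ E] : E →L[ℝ] E :=
  (Complex.I • ContinuousLinearMap.id ℂ E).restrictScalars ℝ

/-- The `(0,1)`-part of the differential of `u`:
`∂̄u(v) = (du(v) + √-1 du(√-1 v)) / 2`. -/
def delbar (u : E → ℂ) (z : E) : E →L[ℝ] ℂ :=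
  (1 / 2 : ℂ) • (fderiv ℝ u z + Complex.I • (fderiv ℝ u z).comp (complexStructure E))

/-- The `2`-form `∂∂̄u`, as the exterior derivative of the `1`-form `∂̄u`. For `u` of class `C²`
one has `∂̄∂̄u = 0`, so that `d∂̄u = ∂∂̄u`. -/
def ddbar (u : E → ℂ) : E → E [⋀^Fin 2]→L[ℝ] ℂ :=
  extDeriv fun z => ContinuousAlternatingMap.ofSubsingleton ℝ E ℂ (0 : Fin 1) (delbar u z)

/-- The pullback `g^*ω` of a `2`-form. -/
def pullback (g : E → F) (ω : F → F [⋀^Fin 2]→L[ℝ] ℂ) (z : E) : E [⋀^Fin 2]→L[ℝ] ℂ :=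
  (ω (g z)).compContinuousLinearMap (fderiv ℝ g z)

end Forms

/-- The Fubini-Study form `(√-1 / 2π) ∂∂̄ log (1 + ‖z‖²)` on the affine chart `ℂ^N` of `ℂℙ^N`. -/
def fubiniStudyForm (N : ℕ) :
    EuclideanSpace ℂ (Fin N) → EuclideanSpace ℂ (Fin N) [⋀^Fin 2]→L[ℝ] ℂ :=
  fun z => (Complex.I / (2 * (Real.pi : ℂ))) •
    ddbar (fun w : EuclideanSpace ℂ (Fin N) => ((Real.log (1 + ‖w‖ ^ 2) : ℝ) : ℂ)) z

/-- The homogeneous coordinates `(1, w_1, …, w_N)` of the point `w` of `ℂ^N ⊂ ℂℙ^N`. -/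
def homogeneousCoords {N : ℕ} (w : EuclideanSpace ℂ (Fin N)) : Fin (N + 1) → ℂ :=
  Fin.cons 1 fun i => w i

theorem homogeneousCoords_ne_zero {N : ℕ} (w : EuclideanSpace ℂ (Fin N)) :
    homogeneousCoords w ≠ 0 := fun h => by
  simpa [homogeneousCoords] using congrFun h 0

/-- The inclusion of the affine chart `ℂ^N ⊂ ℂℙ^N`, `w ↦ [1 : w_1 : … : w_N]`. -/
def toProjective {N : ℕ} (w : EuclideanSpace ℂ (Fin N)) :
    Projectivization ℂ (Fin (N + 1) → ℂ) :=
  Projectivization.mk ℂ (homogeneousCoords w) (homogeneousCoords_ne_zero w)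

/-- `g : Ω → ℂ^N ⊂ ℂℙ^N` is minimally embedded: its image is not contained in a proper
projective subspace of `ℂℙ^N`. -/
def IsMinimallyEmbedded {E : Type*} {N : ℕ} (Ω : Set E) (g : E → EuclideanSpace ℂ (Fin N)) :
    Prop :=
  ∀ S : Projectivization.Subspace ℂ (Fin (N + 1) → ℂ),
    (∀ z ∈ Ω, toProjective (g z) ∈ S) → S = ⊤

/-- `h : Ω → ℂ^m ⊂ ℂℙ^m` is a minimally embedded holomorphic mapping with
`ω_n + f^*ω_d = h^*ω_m` on `Ω`. -/
structure RealizesModification {n d m : ℕ} (Ω : Set (EuclideanSpace ℂ (Fin n)))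
    (f : EuclideanSpace ℂ (Fin n) → EuclideanSpace ℂ (Fin d))
    (h : EuclideanSpace ℂ (Fin n) → EuclideanSpace ℂ (Fin m)) : Prop where
  holomorphic : DifferentiableOn ℂ h Ω
  minimallyEmbedded : IsMinimallyEmbedded Ω h
  isometric : ∀ z ∈ Ω,
    fubiniStudyForm n z + pullback f (fubiniStudyForm d) z = pullback h (fubiniStudyForm m) z

end FubiniStudy

end

/-! Since `(1 + ‖z‖²)(1 + ‖f z‖²)` is the squared norm of the Segre vector `[1:z] ⊗ [1:f z]`, its
logarithm is a potential of `ω_n + f^*ω_d`. The Segre vector has a coordinate equal to `1`. In an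
orthonormal basis of its linear span `V`, with first vector along the projection of that coordinate
vector, it becomes, up to a constant factor, `[1:h]` with `h` minimally embedded
(`exists_minimal_affine_projection`). Thus `m + 1 = dim V`.

Uniqueness is Calabi rigidity (`exists_isometry_of_pullback_eq`). The potentials of two solutions
differ locally by `2 Re g` with `g` holomorphic, so `[1:h]` and `e^g [1:h']` have equal norms.
Polarization gives equal Gram matrices, hence a linear isometry, and the identity theorem carries
the relation to all of `Ω`.

For the bounds, `m + 1` is also the dimension of the space `W` of functions spanned by the products
of `1, z_i` with `1, f_j`. It is at most `(n+1)(d+1)`, and at least `d + 1` since `W` contains the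
span `B` of `1, f_j`. The remaining lower bound (`finrank_affine_mul_lower_bound`) is by induction
on `n`: restriction to an affine hyperplane kills the copy of `B` obtained by multiplying with the
equation of the hyperplane, and the restricted functions are counted by induction. -/

namespace FubiniStudy

/-! ### Regularity and the identity theorem in several complex variables. -/

section SeveralComplexVariables

open Metric Set Filter Topology MeasureTheory

variable {E F : Type*} [NormedAddCommGroup E] [NormedSpace ℂ E]
  [NormedAddCommGroup F] [NormedSpace ℂ F]

/-- Directional derivatives of a holomorphic mapping of several variables are holomorphic. -/
theorem differentiableOn_fderiv_apply [FiniteDimensional ℂ E] [FiniteDimensional ℂ F]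
    {Ω : Set E} (hΩ : IsOpen Ω) {f : E → F} (hf : DifferentiableOn ℂ f Ω) (v : E) :
    DifferentiableOn ℂ (fun z => fderiv ℂ f z v) Ω := by
  have : ProperSpace E := FiniteDimensional.proper ℂ E
  have : ProperSpace F := FiniteDimensional.proper ℂ F
  have : CompleteSpace F := FiniteDimensional.complete ℂ F
  intro z₀ hz₀
  apply DifferentiableAt.differentiableWithinAt
  obtain ⟨ε, hε, hεΩ⟩ := Metric.isOpen_iff.1 hΩ z₀ hz₀
  -- Three nested radii: base points vary within `r`, the circles of integration stay within `2r`,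
  -- and balls of radius `r` about their points stay within `3r`, where `f` is bounded.
  set r : ℝ := ε / 4 with hr
  have hr0 : 0 < r := by positivity
  have hsub : closedBall z₀ (3 * r) ⊆ Ω :=
    (closedBall_subset_ball (by rw [hr]; linarith)).trans hεΩ
  obtain ⟨M, hM⟩ := (isCompact_closedBall z₀ (3 * r)).exists_bound_of_continuousOn
    (hf.continuousOn.mono hsub)
  have hfd : ∀ y ∈ ball z₀ (2 * r), ‖fderiv ℂ f y‖ ≤ (2 * M) / r := by
    intro y hy
    have hb : ball y r ⊆ closedBall z₀ (3 * r) := by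
      intro x hx
      rw [mem_ball] at hx hy
      rw [mem_closedBall]
      linarith [dist_triangle x y z₀]
    refine Complex.norm_fderiv_le_div_of_mapsTo_ball (hf.mono (hb.trans hsub)) ?_ hr0
    intro x hx
    rw [mem_closedBall, dist_eq_norm]
    have h1 := hM x (hb hx)
    have h2 := hM y (hb (mem_ball_self hr0))
    linarith [norm_sub_le (f x) (f y)]
  set δ : ℝ := r / (‖v‖ + 1) with hδ
  have hv : 0 < ‖v‖ + 1 := by positivity
  have hδ0 : 0 < δ := by positivity
  have hδv : ∀ t : ℂ, ‖t‖ ≤ δ → ‖t • v‖ < r := by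
    intro t ht
    rw [norm_smul]
    calc ‖t‖ * ‖v‖ ≤ δ * ‖v‖ := by gcongr
      _ < δ * (‖v‖ + 1) := by gcongr; linarith
      _ = r := by rw [hδ]; field_simp
  have hmem : ∀ z ∈ ball z₀ r, ∀ t : ℂ, ‖t‖ ≤ δ → z + t • v ∈ ball z₀ (2 * r) := by
    intro z hz t ht
    rw [mem_ball, dist_eq_norm] at hz ⊢
    have := hδv t ht
    calc ‖z + t • v - z₀‖ = ‖(z - z₀) + t • v‖ := by congr 1; abel
      _ ≤ ‖z - z₀‖ + ‖t • v‖ := norm_add_le _ _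
      _ < 2 * r := by linarith
  have hsub2 : ball z₀ (2 * r) ⊆ Ω :=
    ((ball_subset_ball (by linarith)).trans ball_subset_closedBall).trans hsub
  have hdiff : ∀ y ∈ ball z₀ (2 * r), HasFDerivAt f (fderiv ℂ f y) y := fun y hy =>
    (hf.differentiableAt (hΩ.mem_nhds (hsub2 hy))).hasFDerivAt
  have hcm : ∀ θ : ℝ, ‖circleMap 0 δ θ‖ ≤ δ := fun θ => by
    rw [norm_circleMap_zero, abs_of_pos hδ0]
  -- the Cauchy integral formula in the direction `v`
  have hcauchy : ∀ z ∈ ball z₀ r, fderiv ℂ f z v =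
      (2 * (Real.pi : ℂ) * Complex.I)⁻¹ •
        ∮ t in C(0, δ), (1 / (t - 0) ^ 2) • f (z + t • v) := by
    intro z hz
    have hline : ∀ t : ℂ, HasDerivAt (fun t : ℂ => z + t • v) v t := fun t => by
      simpa using ((hasDerivAt_id t).smul_const v).const_add z
    have hg : DifferentiableOn ℂ (fun t : ℂ => f (z + t • v)) (closedBall 0 δ) := by
      intro t ht
      have ht' : ‖t‖ ≤ δ := by simpa using ht
      exact ((hdiff _ (hmem z hz t ht')).comp_hasDerivAt t
        (hline t)).differentiableAt.differentiableWithinAt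
    rw [hg.deriv_eq_smul_circleIntegral hδ0, smul_smul,
      inv_mul_cancel₀ Complex.two_pi_I_ne_zero, one_smul]
    have h0 := hmem z hz 0 (by simpa using hδ0.le)
    have := (hdiff _ h0).comp_hasDerivAt (0 : ℂ) (hline 0)
    simpa [Function.comp_def] using this.deriv.symm
  have hcongr : (fun z => fderiv ℂ f z v) =ᶠ[𝓝 z₀] fun z =>
      (2 * (Real.pi : ℂ) * Complex.I)⁻¹ •
        ∮ t in C(0, δ), (1 / (t - 0) ^ 2) • f (z + t • v) := by
    filter_upwards [ball_mem_nhds z₀ hr0] with z hz using hcauchy z hz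
  refine DifferentiableAt.congr_of_eventuallyEq ?_ hcongr
  apply DifferentiableAt.const_smul
  borelize E
  borelize F
  borelize (E →L[ℂ] F)
  set k : ℝ → ℂ := fun θ => deriv (circleMap 0 δ) θ * (1 / (circleMap 0 δ θ - 0) ^ 2) with hk
  have hne : ∀ θ : ℝ, circleMap 0 δ θ - 0 ≠ 0 := fun θ => by
    rw [sub_zero]; exact circleMap_ne_center hδ0.ne'
  have hkc : Continuous k := by
    have h1 : Continuous (deriv (circleMap 0 δ)) := by
      simp only [funext (deriv_circleMap 0 δ)]
      exact (continuous_circleMap 0 δ).mul continuous_const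
    exact h1.mul (continuous_const.div (((continuous_circleMap 0 δ).sub continuous_const).pow 2)
      fun θ => pow_ne_zero 2 (hne θ))
  have hpath : ∀ z, Continuous fun θ : ℝ => z + circleMap 0 δ θ • v := fun z =>
    continuous_const.add ((continuous_circleMap 0 δ).smul continuous_const)
  have hFc : ∀ z ∈ ball z₀ r, Continuous fun θ : ℝ => k θ • f (z + circleMap 0 δ θ • v) := by
    intro z hz
    refine hkc.smul (continuous_iff_continuousAt.2 fun θ => ?_)
    exact ContinuousAt.comp (f := fun θ : ℝ => z + circleMap 0 δ θ • v)
      (hdiff _ (hmem z hz _ (hcm θ))).continuousAt (hpath z).continuousAt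
  -- Continuity of `fderiv ℂ f` is not yet known; its measurability and the Cauchy estimate suffice
  -- to differentiate under the integral.
  have hint := intervalIntegral.hasFDerivAt_integral_of_dominated_of_fderiv_le (𝕜 := ℂ)
    (μ := volume) (a := 0) (b := 2 * Real.pi) (s := ball z₀ r) (x₀ := z₀)
    (F := fun z θ => k θ • f (z + circleMap 0 δ θ • v))
    (F' := fun z θ => k θ • fderiv ℂ f (z + circleMap 0 δ θ • v))
    (bound := fun θ => ‖k θ‖ * ((2 * M) / r)) (ball_mem_nhds z₀ hr0)
    (by
      filter_upwards [ball_mem_nhds z₀ hr0] with z hz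
      exact (hFc z hz).aestronglyMeasurable)
    ((hFc z₀ (mem_ball_self hr0)).intervalIntegrable _ _)
    (by
      refine (hkc.aestronglyMeasurable).smul ?_
      exact ((measurable_fderiv ℂ f).comp
        (hpath z₀).measurable).stronglyMeasurable.aestronglyMeasurable)
    (by
      refine Filter.Eventually.of_forall fun θ _ z hz => ?_
      rw [norm_smul]
      gcongr
      exact hfd _ (hmem z hz _ (hcm θ)))
    ((hkc.norm.mul continuous_const).intervalIntegrable _ _)
    (by
      refine Filter.Eventually.of_forall fun θ _ z hz => ?_
      refine HasFDerivAt.const_smul ?_ (k θ)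
      have := (hdiff _ (hmem z hz _ (hcm θ))).comp z
        ((hasFDerivAt_id z).add_const (circleMap 0 δ θ • v))
      simpa [Function.comp_def] using this)
  refine (hint.differentiableAt).congr_of_eventuallyEq ?_
  refine Filter.Eventually.of_forall fun z => ?_
  simp only [circleIntegral, hk, smul_smul]

/-- Holomorphic mappings of several variables are smooth. -/
theorem contDiffOn_of_holomorphic [FiniteDimensional ℂ E] [FiniteDimensional ℂ F]
    {Ω : Set E} (hΩ : IsOpen Ω) (k : ℕ) {f : E → F} (hf : DifferentiableOn ℂ f Ω) :
    ContDiffOn ℂ k f Ω := by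
  induction k generalizing f with
  | zero => simpa using hf.continuousOn
  | succ k ih =>
    push_cast
    rw [contDiffOn_succ_iff_fderiv_of_isOpen hΩ]
    refine ⟨hf, fun h => by simp at h, ?_⟩
    rw [contDiffOn_clm_apply]
    exact fun v => ih (differentiableOn_fderiv_apply hΩ hf v)

theorem hasDerivAt_line (p v : E) (t : ℂ) : HasDerivAt (fun t : ℂ => p + t • v) v t := by
  simpa using ((hasDerivAt_id t).smul_const v).const_add p

/-- A holomorphic mapping on a convex set is holomorphic along complex lines. -/
theorem differentiableOn_comp_line {B : Set E} (hB : IsOpen B) {f : E → F}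
    (hf : DifferentiableOn ℂ f B) (p v : E) :
    DifferentiableOn ℂ (fun t : ℂ => f (p + t • v)) ((fun t : ℂ => p + t • v) ⁻¹' B) :=
  fun t ht => ((hf.differentiableAt (hB.mem_nhds ht)).hasFDerivAt.comp_hasDerivAt t
    (hasDerivAt_line p v t)).differentiableAt.differentiableWithinAt

theorem isOpen_preimage_line {B : Set E} (hB : IsOpen B) (p v : E) :
    IsOpen ((fun t : ℂ => p + t • v) ⁻¹' B) :=
  hB.preimage (by fun_prop)

theorem convex_preimage_line {B : Set E} (hB : Convex ℝ B) (p v : E) :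
    Convex ℝ ((fun t : ℂ => p + t • v) ⁻¹' B) := by
  intro s hs t ht a b ha hb hab
  have := hB hs ht ha hb hab
  simp only [mem_preimage] at this ⊢
  convert this using 1
  have hp : p = a • p + b • p := by rw [← add_smul, hab, one_smul]
  rw [smul_add, smul_add, add_smul, smul_assoc, smul_assoc]
  conv_lhs => rw [hp]
  abel

/-- Identity theorem on a convex open set. -/
theorem eqOn_zero_of_convex [CompleteSpace F] {B : Set E} (hB : IsOpen B) (hBc : Convex ℝ B)
    {f : E → F} (hf : DifferentiableOn ℂ f B) {p : E} (hp : p ∈ B) (h0 : f =ᶠ[𝓝 p] 0) :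
    EqOn f 0 B := by
  intro z hz
  have han := (differentiableOn_comp_line hB hf p (z - p)).analyticOnNhd
    (isOpen_preimage_line hB p (z - p))
  have h := han.eqOn_zero_of_preconnected_of_eventuallyEq_zero
    (convex_preimage_line hBc p (z - p)).isPreconnected (z₀ := 0) (by simpa using hp) (by
      have hc : Tendsto (fun t : ℂ => p + t • (z - p)) (𝓝 0) (𝓝 p) := by
        have : Continuous fun t : ℂ => p + t • (z - p) := by fun_prop
        simpa using this.tendsto 0
      exact hc.eventually h0)
  simpa using h (x := 1) (by simpa using hz)

/-- Identity theorem for holomorphic mappings of several variables. -/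
theorem eqOn_zero_of_isPreconnected [CompleteSpace F] {Ω : Set E} (hΩ : IsOpen Ω)
    (hc : IsPreconnected Ω) {f : E → F} (hf : DifferentiableOn ℂ f Ω) {p : E} (hp : p ∈ Ω)
    (h0 : f =ᶠ[𝓝 p] 0) : EqOn f 0 Ω := by
  let u : Set E := {z | f =ᶠ[𝓝 z] 0}
  have huo : IsOpen u := isOpen_setOfPred_eventually_nhds
  suffices h : Ω ⊆ u from fun z hz => (h hz).eq_of_nhds
  -- The set of points near which `f` vanishes is open; it is closed in `Ω` because a ball around a
  -- limit point contains one of its points.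
  refine hc.subset_of_closure_inter_subset huo ⟨p, hp, h0⟩ ?_
  rintro q ⟨hq, hqΩ⟩
  obtain ⟨ε, hε, hεΩ⟩ := Metric.isOpen_iff.1 hΩ q hqΩ
  obtain ⟨y, hyu, hy⟩ := Metric.mem_closure_iff.1 hq ε hε
  have := eqOn_zero_of_convex isOpen_ball (convex_ball q ε) (hf.mono hεΩ)
    (p := y) (by rwa [mem_ball, dist_comm]) hyu
  exact this.eventuallyEq_of_mem (ball_mem_nhds q hε)

end SeveralComplexVariables

/-! ### Polarization of Hermitian identities between holomorphic mappings. -/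

section Polarization

open Metric Set Filter Topology

variable {E H : Type*} [NormedAddCommGroup E] [NormedSpace ℂ E]
  [NormedAddCommGroup H] [InnerProductSpace ℂ H]

/-- If `⟪β, α⟫` vanishes on an open set for holomorphic `α, β`, so does `⟪β, deriv α⟫`. -/
theorem inner_deriv_eq_zero {D : Set ℂ} (hD : IsOpen D) {α β : ℂ → H}
    (hα : DifferentiableOn ℂ α D) (hβ : DifferentiableOn ℂ β D)
    (h : ∀ t ∈ D, inner ℂ (β t) (α t) = 0) : ∀ t ∈ D, inner ℂ (β t) (deriv α t) = 0 := by
  intro t ht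
  have ha := (hα.differentiableAt (hD.mem_nhds ht)).hasDerivAt
  have hb := (hβ.differentiableAt (hD.mem_nhds ht)).hasDerivAt
  have key : ∀ w : ℂ, inner ℂ (β t) (w • deriv α t) + inner ℂ (w • deriv β t) (α t) = 0 := by
    intro w
    have hl : HasDerivAt (fun s : ℝ => t + (s : ℂ) * w) w 0 := by
      simpa using ((Complex.ofRealCLM.hasDerivAt (x := (0 : ℝ))).mul_const w).const_add t
    have ha' : HasDerivAt α (deriv α t) ((fun s : ℝ => t + (s : ℂ) * w) 0) := by simpa using ha
    have hb' : HasDerivAt β (deriv β t) ((fun s : ℝ => t + (s : ℂ) * w) 0) := by simpa using hb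
    have hi := (hb'.scomp (0 : ℝ) hl).inner ℂ (ha'.scomp (0 : ℝ) hl)
    have hz : HasDerivAt (fun s : ℝ => inner ℂ ((β ∘ fun s : ℝ => t + (s : ℂ) * w) s)
        ((α ∘ fun s : ℝ => t + (s : ℂ) * w) s)) 0 0 := by
      refine (hasDerivAt_const (0 : ℝ) (0 : ℂ)).congr_of_eventuallyEq ?_
      have : ∀ᶠ s : ℝ in 𝓝 0, t + (s : ℂ) * w ∈ D :=
        hl.continuousAt.eventually_mem (hD.mem_nhds (by simpa using ht))
      filter_upwards [this] with s hs using h _ hs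
    simpa only [Function.comp_apply, Complex.ofReal_zero, zero_mul, add_zero] using hi.unique hz
  -- The first term of `key` is linear in `w` and the second conjugate linear, so `w = 1` and `w =
  -- i` separate them.
  have h1 := key 1
  have h2 := key Complex.I
  simp only [one_smul, inner_smul_left, inner_smul_right, Complex.conj_I] at h1 h2
  have h3 : Complex.I * (inner ℂ (β t) (deriv α t) - inner ℂ (deriv β t) (α t)) = 0 := by
    linear_combination h2
  have h4 := (mul_eq_zero.1 h3).resolve_left Complex.I_ne_zero
  linear_combination (h1 + h4) / 2

/-- Polarization in one variable. -/
theorem inner_eq_zero_of_inner_self_eq_zero [CompleteSpace H] {D : Set ℂ} (hD : IsOpen D) (hDc : IsPreconnected D)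
    {α β : ℂ → H} (hα : DifferentiableOn ℂ α D) (hβ : DifferentiableOn ℂ β D)
    (h : ∀ t ∈ D, inner ℂ (β t) (α t) = 0) {w z : ℂ} (hw : w ∈ D) (hz : z ∈ D) :
    inner ℂ (β w) (α z) = 0 := by
  -- All derivatives of `α` at `w` are orthogonal to `β w`, so the Taylor series of `⟪β w, α t⟫` at
  -- `w` is zero.
  have hiter : ∀ k : ℕ, DifferentiableOn ℂ (iteratedDeriv k α) D ∧
      ∀ t ∈ D, inner ℂ (β t) (iteratedDeriv k α t) = 0 := by
    intro k
    induction k with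
    | zero => simpa using ⟨hα, h⟩
    | succ k ih =>
      rw [iteratedDeriv_succ]
      exact ⟨ih.1.deriv hD, inner_deriv_eq_zero hD ih.1 hβ ih.2⟩
  obtain ⟨r, hr, hrD⟩ := Metric.isOpen_iff.1 hD w hw
  have hloc : (fun t => innerSL ℂ (β w) (α t)) =ᶠ[𝓝 w] 0 := by
    filter_upwards [ball_mem_nhds w hr] with t ht
    have hs := (Complex.hasSum_taylorSeries_on_ball (hα.mono hrD) ht).mapL (innerSL ℂ (β w))
    refine hs.unique ?_
    simp [(hiter _).2 w hw, hasSum_zero]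
  have han : AnalyticOnNhd ℂ (fun t => innerSL ℂ (β w) (α t)) D :=
    ((innerSL ℂ (β w)).differentiable.comp_differentiableOn hα).analyticOnNhd hD
  exact han.eqOn_zero_of_preconnected_of_eventuallyEq_zero hDc hw hloc hz

/-- Polarization on a convex open set of a complex normed space. -/
theorem inner_eq_zero_of_convex [CompleteSpace H] {B : Set E} (hB : IsOpen B) (hBc : Convex ℝ B)
    {a b : E → H} (ha : DifferentiableOn ℂ a B) (hb : DifferentiableOn ℂ b B)
    (h : ∀ z ∈ B, inner ℂ (b z) (a z) = 0) {w z : E} (hw : w ∈ B) (hz : z ∈ B) :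
    inner ℂ (b w) (a z) = 0 := by
  have := inner_eq_zero_of_inner_self_eq_zero (isOpen_preimage_line hB w (z - w))
    (convex_preimage_line hBc w (z - w)).isPreconnected
    (differentiableOn_comp_line hB ha w (z - w)) (differentiableOn_comp_line hB hb w (z - w))
    (fun t ht => h _ ht) (w := 0) (z := 1) (by simpa using hw) (by simpa using hz)
  simpa using this

end Polarization

/-! ### Calculus of `∂̄` and `∂∂̄`; pluriharmonic functions. -/

section Pluriharmonic

open Set Filter Topology

variable {E F : Type*} [NormedAddCommGroup E] [NormedSpace ℂ E]
  [NormedAddCommGroup F] [NormedSpace ℂ F]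

theorem delbar_apply (u : E → ℂ) (z v : E) :
    delbar u z v = (1 / 2) * (fderiv ℝ u z v + Complex.I * fderiv ℝ u z (Complex.I • v)) := by
  simp [delbar, complexStructure, mul_add]

/-- The form `∂̄u` is conjugate linear. -/
theorem delbar_apply_I_smul (u : E → ℂ) (z v : E) :
    delbar u z (Complex.I • v) = -Complex.I * delbar u z v := by
  have hI : Complex.I • Complex.I • v = -v := by
    rw [smul_smul, Complex.I_mul_I, neg_one_smul]
  rw [delbar_apply, delbar_apply, hI, map_neg]
  linear_combination ((1 / 2) * fderiv ℝ u z (Complex.I • v)) * Complex.I_mul_I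

theorem fderiv_real_I_smul {h : E → F} {z : E} (hh : DifferentiableAt ℂ h z) (v : E) :
    fderiv ℝ h z (Complex.I • v) = Complex.I • fderiv ℝ h z v := by
  rw [hh.fderiv_restrictScalars ℝ]
  simp

/-- `∂̄` commutes with holomorphic pullback. -/
theorem delbar_comp {u : F → ℂ} {h : E → F} {z : E} (hu : DifferentiableAt ℝ u (h z))
    (hh : DifferentiableAt ℂ h z) :
    delbar (fun x => u (h x)) z = (delbar u (h z)).comp (fderiv ℝ h z) := by
  ext v
  have hc : fderiv ℝ (fun x => u (h x)) z = (fderiv ℝ u (h z)).comp (fderiv ℝ h z) :=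
    fderiv_comp z hu (hh.restrictScalars ℝ)
  rw [ContinuousLinearMap.comp_apply, delbar_apply, delbar_apply, hc]
  simp [fderiv_real_I_smul hh]

theorem differentiableAt_delbar {u : E → ℂ} {z : E} (hu : ContDiffAt ℝ 2 u z) :
    DifferentiableAt ℝ (delbar u) z := by
  have h1 : DifferentiableAt ℝ (fderiv ℝ u) z :=
    (hu.fderiv_right (m := 1) (by norm_num)).differentiableAt one_ne_zero
  have h2 : DifferentiableAt ℝ (fun z => (fderiv ℝ u z).comp (complexStructure E)) z :=
    h1.clm_comp (differentiableAt_const _)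
  exact (h1.add (h2.const_smul Complex.I)).const_smul (1 / 2 : ℂ)

theorem differentiableAt_ofSubsingleton {ω : E → E →L[ℝ] ℂ} {z : E}
    (hω : DifferentiableAt ℝ ω z) :
    DifferentiableAt ℝ
      (fun z => ContinuousAlternatingMap.ofSubsingleton ℝ E ℂ (0 : Fin 1) (ω z)) z :=
  (ContinuousAlternatingMap.ofSubsingletonLIE (𝕜 := ℝ) (E := E) (F := ℂ)
    (0 : Fin 1)).differentiableAt.comp z hω

/-- `∂∂̄` commutes with holomorphic pullback. -/
theorem ddbar_comp [FiniteDimensional ℂ E] [FiniteDimensional ℂ F] {u : F → ℂ}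
    (hu : ContDiff ℝ 2 u) {Ω : Set E} (hΩ : IsOpen Ω) {h : E → F} (hh : DifferentiableOn ℂ h Ω)
    {z : E} (hz : z ∈ Ω) : ddbar (fun x => u (h x)) z = pullback h (ddbar u) z := by
  have hcd : ContDiffAt ℝ 2 h z :=
    ((contDiffOn_of_holomorphic hΩ 2 hh).contDiffAt (hΩ.mem_nhds hz)).restrict_scalars ℝ
  have hcongr : (fun x => ContinuousAlternatingMap.ofSubsingleton ℝ E ℂ (0 : Fin 1)
        (delbar (fun y => u (h y)) x)) =ᶠ[𝓝 z]
      fun x => (ContinuousAlternatingMap.ofSubsingleton ℝ F ℂ (0 : Fin 1)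
        (delbar u (h x))).compContinuousLinearMap (fderiv ℝ h x) := by
    filter_upwards [hΩ.mem_nhds hz] with x hx
    rw [delbar_comp (hu.differentiable two_ne_zero _) (hh.differentiableAt (hΩ.mem_nhds hx))]
    rfl
  rw [ddbar, hcongr.extDeriv_eq, pullback, ddbar]
  exact extDeriv_pullback
    (ω := fun y => ContinuousAlternatingMap.ofSubsingleton ℝ F ℂ (0 : Fin 1) (delbar u y))
    (differentiableAt_ofSubsingleton (differentiableAt_delbar hu.contDiffAt)) hcd (by simp)

theorem delbar_add {u v : E → ℂ} {z : E} (hu : DifferentiableAt ℝ u z)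
    (hv : DifferentiableAt ℝ v z) :
    delbar (fun x => u x + v x) z = delbar u z + delbar v z := by
  ext x
  simp only [delbar_apply, fderiv_fun_add hu hv, add_apply]
  ring

theorem ddbar_add {u v : E → ℂ} {z : E} (hu : ContDiffAt ℝ 2 u z) (hv : ContDiffAt ℝ 2 v z) :
    ddbar (fun x => u x + v x) z = ddbar u z + ddbar v z := by
  have hcongr : (fun x => ContinuousAlternatingMap.ofSubsingleton ℝ E ℂ (0 : Fin 1)
        (delbar (fun y => u y + v y) x)) =ᶠ[𝓝 z]
      fun x => ContinuousAlternatingMap.ofSubsingleton ℝ E ℂ (0 : Fin 1) (delbar u x) +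
        ContinuousAlternatingMap.ofSubsingleton ℝ E ℂ (0 : Fin 1) (delbar v x) := by
    filter_upwards [hu.eventually (by simp), hv.eventually (by simp)] with x hux hvx
    rw [delbar_add (hux.differentiableAt two_ne_zero) (hvx.differentiableAt two_ne_zero)]
    rfl
  rw [ddbar, hcongr.extDeriv_eq]
  exact extDeriv_fun_add (differentiableAt_ofSubsingleton (differentiableAt_delbar hu))
    (differentiableAt_ofSubsingleton (differentiableAt_delbar hv))

theorem ddbar_add_const (u : E → ℂ) (c : ℂ) : ddbar (fun x => u x + c) = ddbar u := by
  have : delbar (fun x => u x + c) = delbar u := by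
    funext z
    simp only [delbar, fderiv_add_const]
  rw [ddbar, this, ddbar]

theorem ddbar_neg (u : E → ℂ) : ddbar (fun x => -u x) = -ddbar u := by
  have : delbar (fun x => -u x) = fun z => -delbar u z := by
    funext z
    ext v
    simp only [delbar_apply, fderiv_fun_neg, neg_apply]
    ring
  funext z
  rw [ddbar, this]
  have h := extDeriv_smul (x := z) (-1 : ℝ)
    fun z => ContinuousAlternatingMap.ofSubsingleton ℝ E ℂ (0 : Fin 1) (delbar u z)
  rw [neg_one_smul, neg_one_smul] at h
  exact h

theorem _root_.Filter.EventuallyEq.ddbar_eq {u v : E → ℂ} {z : E} (h : u =ᶠ[𝓝 z] v) :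
    ddbar u z = ddbar v z := by
  refine Filter.EventuallyEq.extDeriv_eq ?_
  filter_upwards [h.eventuallyEq_nhds] with x hx
  simp only [delbar, hx.fderiv_eq]

/-- A real function with `∂∂̄u = 0` on a convex open set is the real part of a holomorphic
function. -/
theorem exists_holomorphic_re_of_ddbar_eq_zero {B : Set E} (hB : IsOpen B) (hBc : Convex ℝ B)
    {ρ : E → ℝ} (hρ : ∀ z ∈ B, ContDiffAt ℝ 2 ρ z)
    (h0 : ∀ z ∈ B, ddbar (fun z => (ρ z : ℂ)) z = 0) :
    ∃ g : E → ℂ, DifferentiableOn ℂ g B ∧ ∀ z ∈ B, ρ z = 2 * (g z).re := by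
  set u : E → ℂ := fun z => (ρ z : ℂ) with hu
  have hucd : ∀ z ∈ B, ContDiffAt ℝ 2 u z := fun z hz =>
    Complex.ofRealCLM.contDiff.contDiffAt.comp z (hρ z hz)
  have hd : DifferentiableOn ℝ (delbar u) B := fun z hz =>
    (differentiableAt_delbar (hucd z hz)).differentiableWithinAt
  -- Closedness of `∂̄u` is symmetry of its derivative; the Poincaré lemma on the convex set `B`
  -- then gives a primitive `G`.
  have hsymm : ∀ a ∈ B, ∀ x y, fderiv ℝ (delbar u) a x y = fderiv ℝ (delbar u) a y x := by
    intro a ha x y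
    have hda := differentiableAt_delbar (hucd a ha)
    have h1 := congrArg (fun ω => ω ![x, y]) (h0 a ha)
    simp only [ddbar] at h1
    rw [extDeriv_apply (differentiableAt_ofSubsingleton hda)] at h1
    have hap : ∀ w w' : E, fderiv ℝ (fun z => delbar u z w) a w' = fderiv ℝ (delbar u) a w' w := by
      intro w w'
      rw [fderiv_clm_apply hda (differentiableAt_const w)]
      simp
    simp [Fin.sum_univ_two, Fin.removeNth, hap] at h1
    linear_combination h1
  obtain ⟨G, hG⟩ := hBc.exists_forall_hasFDerivAt_of_fderiv_symmetric hB hd hsymm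
  have hreal : ∀ z ∈ B, ∀ v, (starRingEnd ℂ) (fderiv ℝ u z v) = fderiv ℝ u z v := by
    intro z hz v
    have : HasFDerivAt u (Complex.ofRealCLM.comp (fderiv ℝ ρ z)) z :=
      Complex.ofRealCLM.hasFDerivAt.comp z
        ((hρ z hz).differentiableAt two_ne_zero).hasFDerivAt
    rw [this.fderiv]
    simp
  have hconj : ∀ z ∈ B, HasFDerivAt (fun z => (starRingEnd ℂ) (G z))
      ((Complex.conjCLE : ℂ →L[ℝ] ℂ).comp (delbar u z)) z := fun z hz =>
    (Complex.conjCLE : ℂ →L[ℝ] ℂ).hasFDerivAt.comp z (hG z hz)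
  -- As `u` is real, `du` is `∂̄u` plus its conjugate, so `u` and `G` plus its conjugate have the
  -- same differential.
  have hzero : ∀ z ∈ B, HasFDerivAt (fun z => u z - (G z + (starRingEnd ℂ) (G z)))
      (0 : E →L[ℝ] ℂ) z := by
    intro z hz
    have hsub := (((hucd z hz).differentiableAt two_ne_zero).hasFDerivAt).sub
      ((hG z hz).add (hconj z hz))
    suffices hv : fderiv ℝ u z -
        (delbar u z + (Complex.conjCLE : ℂ →L[ℝ] ℂ).comp (delbar u z)) = 0 by
      rw [hv] at hsub
      exact hsub
    ext v
    simp only [zero_apply, sub_apply,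
      add_apply, ContinuousLinearMap.comp_apply, delbar_apply,
      ContinuousLinearEquiv.coe_coe, Complex.conjCLE_apply, map_mul, map_add, map_div₀, map_one,
      Complex.conj_I, hreal z hz, map_ofNat]
    ring
  rcases B.eq_empty_or_nonempty with rfl | ⟨p, hp⟩
  · exact ⟨0, by simp, by simp⟩
  set c : ℂ := u p - (G p + (starRingEnd ℂ) (G p)) with hc
  have hconst : ∀ z ∈ B, u z - (G z + (starRingEnd ℂ) (G z)) = c := by
    intro z hz
    refine hBc.is_const_of_fderivWithin_eq_zero (𝕜 := ℝ)
      (f := fun z => u z - (G z + (starRingEnd ℂ) (G z)))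
      (fun x hx => (hzero x hx).differentiableAt.differentiableWithinAt) (fun x hx => ?_) hz hp
    rw [fderivWithin_of_isOpen hB hx, (hzero x hx).fderiv]
  -- The differential `∂̄u` of `G` is conjugate linear, so the conjugate of `G` is the holomorphic
  -- one; `c / 2` absorbs the constant of integration.
  refine ⟨fun z => (starRingEnd ℂ) (G z) + c / 2, ?_, fun z hz => ?_⟩
  · intro z hz
    refine DifferentiableAt.differentiableWithinAt (DifferentiableAt.add_const _ ?_)
    rw [differentiableAt_iff_restrictScalars ℝ (hconj z hz).differentiableAt]
    let A : E →L[ℝ] ℂ := (Complex.conjCLE : ℂ →L[ℝ] ℂ).comp (delbar u z)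
    have hAI : ∀ v, A (Complex.I • v) = Complex.I * A v := by
      intro v
      simp [A, delbar_apply_I_smul]
    refine ⟨⟨⟨⟨A, A.map_add⟩, fun w v => ?_⟩, A.continuous⟩, ?_⟩
    · have hw : w • v = w.re • v + w.im • Complex.I • v := by
        conv_lhs => rw [← Complex.re_add_im w, add_smul, mul_smul]
        simp
      change A (w • v) = w * A v
      rw [hw, map_add, map_smul, map_smul, hAI]
      conv_rhs => rw [← Complex.re_add_im w]
      simp only [Complex.real_smul]
      ring
    · rw [(hconj z hz).fderiv]
      rfl
  · have := congrArg Complex.re (hconst z hz)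
    simp [hu] at this
    simp
    linarith

end Pluriharmonic

/-! ### Kähler potentials of pulled back Fubini-Study forms. -/

section Potential

variable {E : Type*} [NormedAddCommGroup E] [NormedSpace ℂ E] [FiniteDimensional ℂ E]

/-- The Kähler potential of the pullback of the Fubini-Study form. -/
noncomputable def potential {N : ℕ} (h : E → EuclideanSpace ℂ (Fin N)) (z : E) : ℝ :=
  Real.log (1 + ‖h z‖ ^ 2)

theorem contDiff_log_one_add_norm_sq (N : ℕ) :
    ContDiff ℝ 2 fun w : EuclideanSpace ℂ (Fin N) => Real.log (1 + ‖w‖ ^ 2) :=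
  (contDiff_const.add (contDiff_norm_sq ℝ)).log fun w => by positivity

theorem contDiffAt_potential {N : ℕ} {Ω : Set E} (hΩ : IsOpen Ω)
    {h : E → EuclideanSpace ℂ (Fin N)} (hh : DifferentiableOn ℂ h Ω) {z : E} (hz : z ∈ Ω) :
    ContDiffAt ℝ 2 (potential h) z :=
  (contDiff_log_one_add_norm_sq N).contDiffAt.comp z
    (((contDiffOn_of_holomorphic hΩ 2 hh).contDiffAt (hΩ.mem_nhds hz)).restrict_scalars ℝ)

theorem contDiffAt_ofReal_potential {N : ℕ} {Ω : Set E} (hΩ : IsOpen Ω)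
    {h : E → EuclideanSpace ℂ (Fin N)} (hh : DifferentiableOn ℂ h Ω) {z : E} (hz : z ∈ Ω) :
    ContDiffAt ℝ 2 (fun z => (potential h z : ℂ)) z :=
  Complex.ofRealCLM.contDiff.contDiffAt.comp z (contDiffAt_potential hΩ hh hz)

theorem pullback_fubiniStudyForm {N : ℕ} {Ω : Set E} (hΩ : IsOpen Ω)
    {h : E → EuclideanSpace ℂ (Fin N)} (hh : DifferentiableOn ℂ h Ω) {z : E} (hz : z ∈ Ω) :
    pullback h (fubiniStudyForm N) z =
      (Complex.I / (2 * (Real.pi : ℂ))) • ddbar (fun z => (potential h z : ℂ)) z := by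
  have hu : ContDiff ℝ 2
      fun w : EuclideanSpace ℂ (Fin N) => ((Real.log (1 + ‖w‖ ^ 2) : ℝ) : ℂ) :=
    Complex.ofRealCLM.contDiff.comp (contDiff_log_one_add_norm_sq N)
  have := ddbar_comp hu hΩ hh hz
  simp only [potential]
  rw [this]
  rfl

theorem I_div_two_pi_ne_zero : Complex.I / (2 * (Real.pi : ℂ)) ≠ 0 := by
  simp [Real.pi_ne_zero]

end Potential

/-! ### Gram matrices and linear isometries. -/

section Gram

variable {ι H H' : Type*} [NormedAddCommGroup H] [InnerProductSpace ℂ H]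
  [NormedAddCommGroup H'] [InnerProductSpace ℂ H']

/-- The squared norm of a combination depends only on the Gram matrix. Hence both families satisfy
the same linear relations, which makes `u i ↦ v i` well defined. -/
theorem norm_linearCombination_eq_of_gram_eq {u : ι → H} {v : ι → H'}
    (huv : ∀ i j, inner ℂ (u i) (u j) = inner ℂ (v i) (v j)) (c : ι →₀ ℂ) :
    ‖Finsupp.linearCombination ℂ u c‖ = ‖Finsupp.linearCombination ℂ v c‖ := by
  have h : inner ℂ (Finsupp.linearCombination ℂ u c) (Finsupp.linearCombination ℂ u c) =
      inner ℂ (Finsupp.linearCombination ℂ v c) (Finsupp.linearCombination ℂ v c) := by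
    simp only [Finsupp.linearCombination_apply, Finsupp.sum, sum_inner, inner_sum,
      inner_smul_left, inner_smul_right, huv]
  rw [inner_self_eq_norm_sq_to_K, inner_self_eq_norm_sq_to_K] at h
  have hsq : ‖Finsupp.linearCombination ℂ u c‖ ^ 2 = ‖Finsupp.linearCombination ℂ v c‖ ^ 2 := by
    exact_mod_cast h
  exact (sq_eq_sq₀ (norm_nonneg _) (norm_nonneg _)).1 hsq

/-- Two spanning families with the same Gram matrix differ by a linear isometry. -/
theorem exists_linearIsometryEquiv_of_gram_eq {u : ι → H} {v : ι → H'}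
    (hu : Submodule.span ℂ (Set.range u) = ⊤) (hv : Submodule.span ℂ (Set.range v) = ⊤)
    (huv : ∀ i j, inner ℂ (u i) (u j) = inner ℂ (v i) (v j)) :
    ∃ e : H ≃ₗᵢ[ℂ] H', ∀ i, e (u i) = v i := by
  have hrange : LinearMap.range (Finsupp.linearCombination ℂ u) = ⊤ := by
    rw [Finsupp.range_linearCombination, hu]
  obtain ⟨s, hs⟩ := LinearMap.exists_rightInverse_of_surjective _ hrange
  have hs' : ∀ x, Finsupp.linearCombination ℂ u (s x) = x := fun x => LinearMap.congr_fun hs x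
  let L : H →ₗᵢ[ℂ] H' :=
    ⟨(Finsupp.linearCombination ℂ v).comp s, fun x => by
      rw [LinearMap.comp_apply, ← norm_linearCombination_eq_of_gram_eq huv, hs']⟩
  have hL : ∀ i, L (u i) = v i := by
    intro i
    -- `s (u i)` and `single i 1` both represent `u i`, so their difference is a relation among the
    -- `u`, hence among the `v`.
    have h1 := norm_linearCombination_eq_of_gram_eq huv (s (u i) - Finsupp.single i 1)
    simp only [map_sub, hs', Finsupp.linearCombination_single, one_smul, sub_self,
      norm_zero] at h1
    exact sub_eq_zero.1 (norm_eq_zero.1 h1.symm)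
  have hsurj : Function.Surjective L := by
    have : LinearMap.range L.toLinearMap = ⊤ := by
      rw [eq_top_iff, ← hv, Submodule.span_le]
      rintro _ ⟨i, rfl⟩
      exact ⟨u i, hL i⟩
    exact LinearMap.range_eq_top.1 this
  exact ⟨LinearIsometryEquiv.ofSurjective L hsurj, hL⟩

/-- Linear isometries of `ℂ^N` are given by unitary matrices. -/
theorem exists_mem_unitaryGroup {N : ℕ}
    (e : EuclideanSpace ℂ (Fin N) ≃ₗᵢ[ℂ] EuclideanSpace ℂ (Fin N)) :
    ∃ U ∈ Matrix.unitaryGroup (Fin N) ℂ, ∀ x, WithLp.ofLp (e x) = U *ᵥ WithLp.ofLp x := by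
  let a := EuclideanSpace.basisFun (Fin N) ℂ
  let b := a.map e
  refine ⟨a.toBasis.toMatrix b, a.toMatrix_orthonormalBasis_mem_unitary b, fun x => ?_⟩
  have hx : e x = ∑ j, x j • b j := by
    conv_lhs => rw [← a.sum_repr x, map_sum]
    simp [b, a]
  rw [hx]
  funext i
  simp [Matrix.mulVec, dotProduct, Module.Basis.toMatrix_apply, a, mul_comm]

end Gram

/-! ### Homogeneous coordinates and minimality as a spanning condition. -/

section HomogeneousCoordinates

/-- The homogeneous coordinates as a vector of the Hermitian space `ℂ^{N+1}`. -/
noncomputable def homVec {N : ℕ} (w : EuclideanSpace ℂ (Fin N)) :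
    EuclideanSpace ℂ (Fin (N + 1)) :=
  WithLp.toLp 2 (homogeneousCoords w)

@[simp]
theorem homVec_zero {N : ℕ} (w : EuclideanSpace ℂ (Fin N)) : homVec w 0 = 1 := rfl

@[simp]
theorem homVec_succ {N : ℕ} (w : EuclideanSpace ℂ (Fin N)) (i : Fin N) :
    homVec w i.succ = w i := rfl

theorem homVec_ne_zero {N : ℕ} (w : EuclideanSpace ℂ (Fin N)) : homVec w ≠ 0 := fun h => by
  simpa using congrArg (fun x : EuclideanSpace ℂ (Fin (N + 1)) => x 0) h

theorem inner_homVec {N : ℕ} (w z : EuclideanSpace ℂ (Fin N)) :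
    inner ℂ (homVec w) (homVec z) = 1 + inner ℂ w z := by
  simp [PiLp.inner_apply, Fin.sum_univ_succ]

/-- This makes the potential the logarithm of the squared norm of a holomorphic vector, the form to
which polarization applies. -/
theorem norm_homVec_sq {N : ℕ} (w : EuclideanSpace ℂ (Fin N)) :
    ‖homVec w‖ ^ 2 = 1 + ‖w‖ ^ 2 := by
  simp [EuclideanSpace.norm_sq_eq, Fin.sum_univ_succ]

theorem differentiable_homVec {N : ℕ} :
    Differentiable ℂ (homVec : EuclideanSpace ℂ (Fin N) → EuclideanSpace ℂ (Fin (N + 1))) := by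
  rw [differentiable_euclidean]
  intro i
  refine Fin.cases ?_ (fun j => ?_) i
  · simp
  · simpa using (EuclideanSpace.proj (𝕜 := ℂ) j).differentiable

/-- Projective subspaces correspond to linear subspaces, with top corresponding to top. -/
theorem isMinimallyEmbedded_iff_span {E : Type*} {N : ℕ} {Ω : Set E}
    {g : E → EuclideanSpace ℂ (Fin N)} :
    IsMinimallyEmbedded Ω g ↔
      Submodule.span ℂ ((fun z => homogeneousCoords (g z)) '' Ω) = ⊤ := by
  constructor
  · intro h
    have := h (Submodule.span ℂ ((fun z => homogeneousCoords (g z)) '' Ω)).projectivization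
      fun z hz => by
        rw [toProjective, Submodule.mk_mem_projectivization_iff]
        exact Submodule.subset_span ⟨z, hz, rfl⟩
    exact (map_eq_top_iff (f := Submodule.projectivization)).1 this
  · intro h S hS
    refine (map_eq_top_iff (f := Projectivization.Subspace.submodule)).1 ?_
    rw [eq_top_iff, ← h, Submodule.span_le]
    rintro _ ⟨z, hz, rfl⟩
    exact (Projectivization.Subspace.mem_submodule_iff S (homogeneousCoords_ne_zero _)).2 (hS z hz)

theorem isMinimallyEmbedded_iff_span_homVec {E : Type*} {N : ℕ} {Ω : Set E}
    {g : E → EuclideanSpace ℂ (Fin N)} :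
    IsMinimallyEmbedded Ω g ↔ Submodule.span ℂ ((fun z => homVec (g z)) '' Ω) = ⊤ := by
  let e := (WithLp.linearEquiv 2 ℂ (Fin (N + 1) → ℂ)).symm
  have h : Submodule.span ℂ ((fun z => homVec (g z)) '' Ω) =
      (Submodule.span ℂ ((fun z => homogeneousCoords (g z)) '' Ω)).map e.toLinearMap := by
    rw [Submodule.map_span, Set.image_image]
    rfl
  rw [isMinimallyEmbedded_iff_span, h]
  exact (map_eq_top_iff (f := Submodule.orderIsoMapComap e)).symm

/-- The affine coordinates of a minimally embedded mapping span `ℂ^N`. -/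
theorem IsMinimallyEmbedded.span_image_eq_top {E : Type*} {N : ℕ} {Ω : Set E}
    {g : E → EuclideanSpace ℂ (Fin N)} (hg : IsMinimallyEmbedded Ω g) :
    Submodule.span ℂ (g '' Ω) = ⊤ := by
  let T : EuclideanSpace ℂ (Fin (N + 1)) →ₗ[ℂ] EuclideanSpace ℂ (Fin N) :=
    { toFun := fun x => WithLp.toLp 2 fun i => x i.succ
      map_add' := fun x y => rfl
      map_smul' := fun c x => rfl }
  have hT : Function.Surjective T := fun y => ⟨homVec y, rfl⟩
  have h := congrArg (Submodule.map T) (isMinimallyEmbedded_iff_span_homVec.1 hg)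
  rw [Submodule.map_span, Set.image_image, Submodule.map_top, LinearMap.range_eq_top.2 hT] at h
  exact h

end HomogeneousCoordinates

/-! ### Normalization at a common zero. -/

section CommonZero

/-- Isometries of the homogeneous coordinates of two mappings that vanish at a common point
restrict to isometries of the affine coordinates. -/
theorem inner_eq_inner_of_common_zero {E : Type*} {m m' : ℕ} {Ω : Set E}
    {h : E → EuclideanSpace ℂ (Fin m)} {h' : E → EuclideanSpace ℂ (Fin m')}
    (e : EuclideanSpace ℂ (Fin (m + 1)) ≃ₗᵢ[ℂ] EuclideanSpace ℂ (Fin (m' + 1)))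
    (he : ∀ z ∈ Ω, ∃ c : ℂ, c ≠ 0 ∧ e (homVec (h z)) = c • homVec (h' z))
    {p : E} (hp : p ∈ Ω) (hhp : h p = 0) (hhp' : h' p = 0) {w z : E} (hw : w ∈ Ω) (hz : z ∈ Ω) :
    inner ℂ (h w) (h z) = inner ℂ (h' w) (h' z) := by
  choose! c hc0 hc using he
  have key : ∀ x ∈ Ω, ∀ y ∈ Ω, 1 + inner ℂ (h x) (h y) =
      (starRingEnd ℂ) (c x) * c y * (1 + inner ℂ (h' x) (h' y)) := by
    intro x hx y hy
    rw [← inner_homVec, ← inner_homVec, ← e.inner_map_map, hc x hx, hc y hy, inner_smul_left,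
      inner_smul_right, mul_assoc]
  -- At the common zero `p` both inner products vanish; this forces the factor `c` to be constant
  -- and unimodular.
  have h1 : ∀ y ∈ Ω, (starRingEnd ℂ) (c p) * c y = 1 := by
    intro y hy
    simpa [hhp, hhp'] using (key p hp y hy).symm
  have hcp : (starRingEnd ℂ) (c p) ≠ 0 := by simpa using hc0 p hp
  have hconst : ∀ y ∈ Ω, c y = c p := fun y hy =>
    mul_left_cancel₀ hcp ((h1 y hy).trans (h1 p hp).symm)
  have := key w hw z hz
  rw [hconst w hw, hconst z hz, h1 p hp, one_mul] at this
  exact add_left_cancel this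

end CommonZero

/-! ### Calabi rigidity. -/

section Rigidity

open Metric Set Filter Topology

variable {E : Type*} [NormedAddCommGroup E] [NormedSpace ℂ E]

/-- A holomorphic mapping on a connected set that spans does so near each point. -/
theorem span_image_eq_top_of_isOpen {V : Type*} [NormedAddCommGroup V] [InnerProductSpace ℂ V]
    [FiniteDimensional ℂ V] {Ω B : Set E} (hΩ : IsOpen Ω) (hc : IsPreconnected Ω)
    (hB : IsOpen B) (hBΩ : B ⊆ Ω) (hne : B.Nonempty) {g : E → V} (hg : DifferentiableOn ℂ g Ω)
    (hspan : Submodule.span ℂ (g '' Ω) = ⊤) : Submodule.span ℂ (g '' B) = ⊤ := by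
  obtain ⟨p, hp⟩ := hne
  rw [← Submodule.orthogonal_eq_bot_iff, Submodule.eq_bot_iff]
  intro x hx
  -- A vector orthogonal to all values on `B` gives a holomorphic function vanishing on `B`, hence
  -- on `Ω`.
  have h0 : EqOn (fun z => innerSL ℂ x (g z)) 0 Ω := by
    refine eqOn_zero_of_isPreconnected hΩ hc
      ((innerSL ℂ x).differentiable.comp_differentiableOn hg) (hBΩ hp) ?_
    filter_upwards [hB.mem_nhds hp] with z hz
    exact (Submodule.mem_orthogonal' _ _).1 hx _ (Submodule.subset_span ⟨z, hz, rfl⟩)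
  have hle : Submodule.span ℂ (g '' Ω) ≤ LinearMap.ker (innerSL ℂ x).toLinearMap := by
    rw [Submodule.span_le]
    rintro _ ⟨z, hz, rfl⟩
    exact h0 hz
  rw [hspan] at hle
  have : inner ℂ x x = 0 := hle (Submodule.mem_top (x := x))
  exact inner_self_eq_zero.1 this

/-- Polarization of an identity of squared norms. -/
theorem inner_eq_inner_of_norm_eq {H H' : Type*} [NormedAddCommGroup H] [InnerProductSpace ℂ H]
    [CompleteSpace H] [NormedAddCommGroup H'] [InnerProductSpace ℂ H'] [CompleteSpace H']
    {B : Set E} (hB : IsOpen B) (hBc : Convex ℝ B) {a : E → H} {b : E → H'}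
    (ha : DifferentiableOn ℂ a B) (hb : DifferentiableOn ℂ b B)
    (h : ∀ z ∈ B, ‖a z‖ = ‖b z‖) {w z : E} (hw : w ∈ B) (hz : z ∈ B) :
    inner ℂ (a w) (a z) = inner ℂ (b w) (b z) := by
  -- In the Hilbert sum, the inner product of `(a, -b)` with `(a, b)` is `‖a‖² - ‖b‖² = 0`, so
  -- polarization to zero applies.
  let e := (WithLp.prodContinuousLinearEquiv 2 ℂ H H').symm
  have h1 : DifferentiableOn ℂ (fun z => e (a z, b z)) B :=
    e.differentiable.comp_differentiableOn (ha.prodMk hb)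
  have h2 : DifferentiableOn ℂ (fun z => e (a z, -b z)) B :=
    e.differentiable.comp_differentiableOn (ha.prodMk hb.neg)
  have h3 := inner_eq_zero_of_convex hB hBc h1 h2 (fun z hz => by
    simp [e, WithLp.prod_inner_apply, inner_self_eq_norm_sq_to_K, h z hz]) hw hz
  simp [e, WithLp.prod_inner_apply] at h3
  linear_combination h3

variable [FiniteDimensional ℂ E]

/-- Calabi rigidity: two minimally embedded holomorphic mappings that induce the same form differ by
a unitary transformation of the projective space. -/
theorem exists_isometry_of_pullback_eq {m m' : ℕ} {Ω : Set E} (hΩ : IsOpen Ω)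
    (hc : IsConnected Ω) {h : E → EuclideanSpace ℂ (Fin m)} {h' : E → EuclideanSpace ℂ (Fin m')}
    (hh : DifferentiableOn ℂ h Ω) (hh' : DifferentiableOn ℂ h' Ω)
    (hmin : IsMinimallyEmbedded Ω h) (hmin' : IsMinimallyEmbedded Ω h')
    (heq : ∀ z ∈ Ω, pullback h (fubiniStudyForm m) z = pullback h' (fubiniStudyForm m') z) :
    ∃ e : EuclideanSpace ℂ (Fin (m + 1)) ≃ₗᵢ[ℂ] EuclideanSpace ℂ (Fin (m' + 1)),
      ∀ z ∈ Ω, ∃ c : ℂ, c ≠ 0 ∧ e (homVec (h z)) = c • homVec (h' z) := by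
  obtain ⟨p, hp⟩ := hc.nonempty
  obtain ⟨ε, hε, hεΩ⟩ := Metric.isOpen_iff.1 hΩ p hp
  have hdd : ∀ z ∈ ball p ε,
      ddbar (fun z => ((potential h z - potential h' z : ℝ) : ℂ)) z = 0 := by
    intro z hz
    have h1 := heq z (hεΩ hz)
    rw [pullback_fubiniStudyForm hΩ hh (hεΩ hz), pullback_fubiniStudyForm hΩ hh' (hεΩ hz)] at h1
    have h2 := (IsUnit.mk0 _ I_div_two_pi_ne_zero).smul_left_cancel.1 h1
    have h3 := ddbar_add (contDiffAt_ofReal_potential hΩ hh (hεΩ hz))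
      (contDiffAt_ofReal_potential hΩ hh' (hεΩ hz)).neg
    rw [ddbar_neg, Pi.neg_apply, h2, add_neg_cancel] at h3
    simp only [Complex.ofReal_sub]
    simpa only [sub_eq_add_neg] using h3
  obtain ⟨g, hg, hgre⟩ := exists_holomorphic_re_of_ddbar_eq_zero isOpen_ball (convex_ball p ε)
    (fun z hz => (contDiffAt_potential hΩ hh (hεΩ hz)).sub
      (contDiffAt_potential hΩ hh' (hεΩ hz))) hdd
  have hH : DifferentiableOn ℂ (fun z => homVec (h z)) Ω :=
    differentiable_homVec.comp_differentiableOn hh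
  have hH' : DifferentiableOn ℂ (fun z => homVec (h' z)) Ω :=
    differentiable_homVec.comp_differentiableOn hh'
  have hnorm : ∀ z ∈ ball p ε, ‖homVec (h z)‖ = ‖Complex.exp (g z) • homVec (h' z)‖ := by
    intro z hz
    have h1 := hgre z hz
    have hpos : (0 : ℝ) < 1 + ‖h z‖ ^ 2 := by positivity
    have hpos' : (0 : ℝ) < 1 + ‖h' z‖ ^ 2 := by positivity
    have h2 : 1 + ‖h z‖ ^ 2 = Real.exp (g z).re ^ 2 * (1 + ‖h' z‖ ^ 2) := by
      rw [← Real.exp_log hpos, ← Real.exp_log hpos', ← Real.exp_nat_mul, ← Real.exp_add]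
      congr 1
      simp only [potential] at h1
      push_cast
      linarith
    rw [← sq_eq_sq₀ (norm_nonneg _) (norm_nonneg _), norm_smul, mul_pow, norm_homVec_sq,
      norm_homVec_sq, Complex.norm_exp, h2]
  have hgram := fun w (hw : w ∈ ball p ε) z (hz : z ∈ ball p ε) =>
    inner_eq_inner_of_norm_eq isOpen_ball (convex_ball p ε) (hH.mono hεΩ)
      (hg.cexp.smul (hH'.mono hεΩ)) hnorm hw hz
  have hspan := span_image_eq_top_of_isOpen hΩ hc.isPreconnected isOpen_ball hεΩ
    ⟨p, mem_ball_self hε⟩ hH (isMinimallyEmbedded_iff_span_homVec.1 hmin)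
  have hspan' := span_image_eq_top_of_isOpen hΩ hc.isPreconnected isOpen_ball hεΩ
    ⟨p, mem_ball_self hε⟩ hH' (isMinimallyEmbedded_iff_span_homVec.1 hmin')
  obtain ⟨e, he⟩ := exists_linearIsometryEquiv_of_gram_eq (ι := ball p ε)
    (u := fun z => homVec (h z)) (v := fun z => Complex.exp (g z) • homVec (h' z))
    (by rwa [image_eq_range] at hspan)
    (by
      rw [eq_top_iff, ← hspan', Submodule.span_le]
      rintro _ ⟨z, hz, rfl⟩
      have := Submodule.smul_mem _ (Complex.exp (g z))⁻¹ (Submodule.subset_span (R := ℂ)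
        (mem_range_self (f := fun z : ball p ε => Complex.exp (g z) • homVec (h' z)) ⟨z, hz⟩))
      simpa [smul_smul, inv_mul_cancel₀ (Complex.exp_ne_zero (g z))] using this)
    fun w z => hgram w w.2 z z.2
  have heH : DifferentiableOn ℂ (fun z => e (homVec (h z))) Ω :=
    e.differentiable.comp_differentiableOn hH
  have hc0 : DifferentiableOn ℂ (fun z => e (homVec (h z)) 0) Ω :=
    (EuclideanSpace.proj (𝕜 := ℂ) (0 : Fin (m' + 1))).differentiable.comp_differentiableOn heH
  -- On the ball the zeroth coordinate of `e (homVec (h z))` is `exp (g z)`, because that of `homVec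
  -- (h' z)` is `1`. Written with this coordinate, the relation no longer involves the local
  -- function `g` and extends to `Ω`.
  have hglob : EqOn (fun z => e (homVec (h z)) - e (homVec (h z)) 0 • homVec (h' z)) 0 Ω := by
    refine eqOn_zero_of_isPreconnected hΩ hc.isPreconnected (heH.sub (hc0.smul hH')) hp ?_
    filter_upwards [ball_mem_nhds p hε] with z hz
    have := he ⟨z, hz⟩
    simp only at this
    simp [this]
  refine ⟨e, fun z hz => ⟨e (homVec (h z)) 0, fun h0 => ?_, sub_eq_zero.1 (hglob hz)⟩⟩
  have h1 := sub_eq_zero.1 (hglob hz)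
  simp only [h0, zero_smul] at h1
  exact homVec_ne_zero _ (e.map_eq_zero_iff.1 h1)

end Rigidity

/-! ### Dimension of products of affine functions with a space of functions. -/

section DimensionBound

open Module

/-- Finitely many points separate a finite-dimensional space of functions. -/
theorem exists_linearIndependent_evaluation {X : Type*} (B : Submodule ℂ (X → ℂ))
    [FiniteDimensional ℂ B] {r : ℕ} (hr : r ≤ finrank ℂ B) :
    ∃ x : Fin r → X, LinearIndependent ℂ fun i =>
      (LinearMap.proj (R := ℂ) (φ := fun _ : X => ℂ) (x i)).comp B.subtype := by
  let ev : X → Dual ℂ B := fun x => (LinearMap.proj (R := ℂ) (φ := fun _ : X => ℂ) x).comp B.subtype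
  -- A functional on the dual killing all evaluations comes from some `b` in `B` that vanishes at
  -- every point.
  have hspan : Submodule.span ℂ (Set.range ev) = ⊤ := by
    by_contra hne
    obtain ⟨φ, hφ, hle⟩ := Submodule.exists_le_ker_of_lt_top _ (lt_top_iff_ne_top.2 hne)
    obtain ⟨b, rfl⟩ := (evalEquiv ℂ B).surjective φ
    refine hφ ?_
    have hb : b = 0 := by
      ext x
      exact hle (Submodule.subset_span ⟨x, rfl⟩)
    rw [hb, map_zero]
  obtain ⟨v, hv, -, hli⟩ := Submodule.exists_fun_fin_finrank_span_eq ℂ (Set.range ev)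
  have hfr : r ≤ finrank ℂ (Submodule.span ℂ (Set.range ev)) := by
    rw [hspan, finrank_top, Subspace.dual_finrank_eq]
    exact hr
  choose x hx using hv
  refine ⟨fun i => x (Fin.castLE hfr i), ?_⟩
  obtain rfl : (fun i => ev (x i)) = v := funext hx
  exact hli.comp (Fin.castLE hfr) (Fin.castLE_injective hfr)

theorem exists_submodule_le_finrank_eq {V : Type*} [AddCommGroup V] [Module ℂ V]
    (B : Submodule ℂ V) [FiniteDimensional ℂ B] {r : ℕ} (hr : r ≤ finrank ℂ B) :
    ∃ B' ≤ B, finrank ℂ B' = r := by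
  let b := finBasis ℂ B
  have hli : LinearIndependent ℂ fun i : Fin r => (b (Fin.castLE hr i) : V) :=
    (b.linearIndependent.map' B.subtype (Submodule.ker_subtype B)).comp _
      (Fin.castLE_injective hr)
  refine ⟨Submodule.span ℂ (Set.range fun i : Fin r => (b (Fin.castLE hr i) : V)), ?_, ?_⟩
  · rw [Submodule.span_le]
    rintro _ ⟨i, rfl⟩
    exact (b _).2
  · rw [finrank_span_eq_card hli, Fintype.card_fin]

/-- Rank-nullity on `W`. In the induction `r` restricts to a hyperplane and `C` consists of the
multiples of its equation by elements of `B`. -/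
theorem finrank_map_add_finrank_le {V V' : Type*} [AddCommGroup V] [Module ℂ V] [AddCommGroup V']
    [Module ℂ V'] (r : V →ₗ[ℂ] V') (W C : Submodule ℂ V) [FiniteDimensional ℂ W]
    (hC : C ≤ W) (hr : C ≤ LinearMap.ker r) :
    finrank ℂ (W.map r) + finrank ℂ C ≤ finrank ℂ W := by
  have h := LinearMap.finrank_range_add_finrank_ker (r.domRestrict W)
  rw [LinearMap.range_domRestrict] at h
  rw [← h]
  gcongr
  refine LinearMap.finrank_le_finrank_of_injective
    (f := (Submodule.inclusion hC).codRestrict (LinearMap.ker (r.domRestrict W))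
      fun c => hr c.2) fun a b hab => ?_
  exact Subtype.ext 
    (congrArg (fun x : LinearMap.ker (r.domRestrict W) => ((x : W) : V)) hab)

/-- Multiplication by a nonconstant affine function is injective on continuous functions. -/
theorem eq_zero_of_affine_mul_eq_zero {E : Type*} [NormedAddCommGroup E] [NormedSpace ℂ E]
    {X : Set E} (hX : IsOpen X) {ℓ : E →L[ℂ] ℂ} (hℓ : ℓ ≠ 0) (c : ℂ) {b : X → ℂ}
    (hb : Continuous b) (h : ∀ x : X, (ℓ x - c) * b x = 0) : b = 0 := by
  have hopen : IsOpenMap fun x : X => ℓ x :=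
    (ℓ.isOpenMap_of_ne_zero hℓ).comp hX.isOpenMap_subtype_val
  have hdense : Dense ((fun x : X => ℓ x) ⁻¹' {c}ᶜ) := (dense_compl_singleton c).preimage hopen
  refine hb.ext_on hdense continuous_const fun x hx => ?_
  exact (mul_eq_zero.1 (h x)).resolve_left (sub_ne_zero.2 hx)

/-- A lower bound for the dimension of the product of the space of affine functions with a
`(d+1)`-dimensional space of continuous functions. -/
theorem finrank_affine_mul_lower_bound (n : ℕ) {E : Type*} [NormedAddCommGroup E]
    [NormedSpace ℂ E] [FiniteDimensional ℂ E] (hE : finrank ℂ E = n) {X : Set E} (hX : IsOpen X)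
    {d : ℕ} (hd : d ≤ n) (B W : Submodule ℂ (X → ℂ)) [FiniteDimensional ℂ W]
    (hB : finrank ℂ B = d + 1) (hcont : ∀ b ∈ B, Continuous b) (hBW : B ≤ W)
    (hmul : ∀ φ : E →ₗ[ℂ] ℂ, ∀ b ∈ B, (fun x : X => φ x * b x) ∈ W) :
    2 * ((n + 1) * (d + 1)) ≤ 2 * finrank ℂ W + d * (d + 1) := by
  induction n generalizing E d with
  | zero =>
    obtain rfl : d = 0 := by omega
    have := Submodule.finrank_mono hBW
    omega
  | succ k ih =>
    have : FiniteDimensional ℂ B := Submodule.finiteDimensional_of_le hBW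
    -- In dimension `k + 1`, any `q + 1 ≤ k + 1` points lie on an affine hyperplane. Taking points
    -- at which the evaluations on `B` are independent keeps the restriction of `B` of dimension at
    -- least `q + 1`.
    set q := min d k with hq
    obtain ⟨x, hx⟩ := exists_linearIndependent_evaluation B (r := q + 1) (by omega)
    let p : E := x 0
    let S : Submodule ℂ E := Submodule.span ℂ (Set.range fun i : Fin q => (x i.succ : E) - p)
    have hS : S < ⊤ := by
      refine Submodule.lt_top_of_finrank_lt_finrank ?_
      have h1 : finrank ℂ S ≤ Fintype.card (Fin q) := finrank_range_le_card _
      rw [Fintype.card_fin] at h1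
      omega
    obtain ⟨ℓ, hℓ, hSℓ⟩ := Submodule.exists_le_ker_of_lt_top S hS
    let K : Submodule ℂ E := LinearMap.ker ℓ
    have hK : finrank ℂ K = k := by
      have := Module.Dual.finrank_ker_add_one_of_ne_zero (f := ℓ) hℓ
      change finrank ℂ K + 1 = _ at this
      omega
    have hxK : ∀ i, (x i : E) - p ∈ K := by
      intro i
      refine Fin.cases ?_ (fun j => ?_) i
      · simp [p]
      · exact hSℓ (Submodule.subset_span ⟨j, rfl⟩)
    let X' : Set K := {y | p + (y : E) ∈ X}
    have hX' : IsOpen X' := hX.preimage (by fun_prop : Continuous fun y : K => p + (y : E))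
    let j : X' → X := fun y => ⟨p + (y : K), y.2⟩
    have hj : Continuous j := by fun_prop
    let r : (X → ℂ) →ₗ[ℂ] (X' → ℂ) := LinearMap.funLeft ℂ ℂ j
    let y : Fin (q + 1) → X' := fun i => ⟨⟨x i - p, hxK i⟩, by simp [X']⟩
    have hjy : ∀ i, j (y i) = x i := fun i => Subtype.ext (by simp [j, y])
    -- the restriction of `B` to the hyperplane has dimension at least `q + 1`
    have hrank : q + 1 ≤ finrank ℂ (B.map r) := by
      let R : B →ₗ[ℂ] B.map r := r.submoduleMap B
      have hli : LinearIndependent ℂ fun i =>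
          (LinearMap.proj (R := ℂ) (φ := fun _ : X' => ℂ) (y i)).comp (B.map r).subtype := by
        refine LinearIndependent.of_comp (Module.Dual.transpose (R := ℂ) R) ?_
        convert hx using 2 with i
        ext b
        change (b : X → ℂ) (j (y i)) = (b : X → ℂ) (x i)
        rw [hjy]
      have := hli.fintype_card_le_finrank
      rwa [Fintype.card_fin, Subspace.dual_finrank_eq] at this
    obtain ⟨B', hB'le, hB'⟩ := exists_submodule_le_finrank_eq (B.map r) hrank
    have hih := ih hK hX' (d := q) (by omega) B' (W.map r) hB'
      (by
        intro b' hb'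
        obtain ⟨b, hb, rfl⟩ := hB'le hb'
        exact (hcont b hb).comp hj)
      (hB'le.trans (Submodule.map_mono hBW))
      (by
        intro φ b' hb'
        obtain ⟨b, hb, rfl⟩ := hB'le hb'
        obtain ⟨ψ, hψ⟩ := LinearMap.exists_extend φ
        -- On `p + K` the extension `ψ` equals `ψ p + φ`; the constant part is corrected by a
        -- multiple of `b`, which lies in `W`.
        refine ⟨(fun x : X => ψ x * b x) - ψ p • b,
          W.sub_mem (hmul ψ b hb) (W.smul_mem _ (hBW hb)), ?_⟩
        funext z
        have hz : φ z = ψ (z : K) := (LinearMap.congr_fun hψ z).symm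
        simp only [r, LinearMap.funLeft_apply, Pi.sub_apply, Pi.smul_apply, smul_eq_mul, j, hz,
          map_add]
        ring)
    -- Multiplication by the equation `ℓ - ℓ p` of the hyperplane embeds `B` into the functions of
    -- `W` that restrict to zero.
    let μ : (X → ℂ) →ₗ[ℂ] (X → ℂ) := LinearMap.mulLeft ℂ fun x : X => ℓ x - ℓ p
    have hμ : Function.Injective (μ.domRestrict B) := by
      rw [injective_iff_map_eq_zero]
      intro b hb
      refine Subtype.ext (eq_zero_of_affine_mul_eq_zero hX (ℓ := ℓ.toContinuousLinearMap) ?_ (ℓ p)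
        (hcont b b.2) fun x => congrFun hb x)
      simpa using hℓ
    have hμB : finrank ℂ (B.map μ) = d + 1 := by
      rw [← LinearMap.range_domRestrict, LinearMap.finrank_range_of_inj hμ, hB]
    have hfin := finrank_map_add_finrank_le r W (B.map μ)
      (by
        rintro _ ⟨b, hb, rfl⟩
        have : μ b = (fun x : X => ℓ x * b x) - ℓ p • b := by
          funext x
          simp [μ, sub_mul]
        rw [this]
        exact W.sub_mem (hmul ℓ b hb) (W.smul_mem _ (hBW hb)))
      (by
        rintro _ ⟨b, hb, rfl⟩
        rw [LinearMap.mem_ker]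
        funext z
        have hz : ℓ (z : K) = 0 := (z : K).2
        simp [r, μ, j, hz])
    rw [hμB] at hfin
    -- If `d ≤ k`, the restriction loses no dimension of `B`; if `d = k + 1`, only dimension `k + 1`
    -- is guaranteed, and the estimate still closes.
    rcases Nat.lt_or_ge k d with hkd | hkd
    · obtain rfl : d = k + 1 := by omega
      have hqk : q = k := by omega
      rw [hqk] at hih
      nlinarith
    · have hqd : q = d := by omega
      rw [hqd] at hih
      nlinarith

end DimensionBound

/-! ### The Segre construction and the dimension of its span. -/

section Existence

open Module

/-- A mapping into a Hermitian space with a constant component is, up to a constant factor and an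
isometry of its linear span, a minimally embedded mapping in homogeneous coordinates. -/
theorem exists_minimal_affine_projection {E H : Type*} [NormedAddCommGroup H]
    [InnerProductSpace ℂ H] [FiniteDimensional ℂ H] {Ω : Set E} (hne : Ω.Nonempty) (F : E → H)
    (v : H) (hv : ∀ z ∈ Ω, inner ℂ v (F z) = 1) :
    ∃ (m : ℕ) (T : H →L[ℂ] EuclideanSpace ℂ (Fin m)) (κ : ℝ),
      finrank ℂ (Submodule.span ℂ (F '' Ω)) = m + 1 ∧ 0 < κ ∧
      (∀ z ∈ Ω, 1 + ‖T (F z)‖ ^ 2 = κ * ‖F z‖ ^ 2) ∧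
      IsMinimallyEmbedded Ω (fun z => T (F z)) ∧ (v ∈ F '' Ω → T v = 0) := by
  obtain ⟨z₀, hz₀⟩ := hne
  set V : Submodule ℂ H := Submodule.span ℂ (F '' Ω) with hV
  have hFV : ∀ z ∈ Ω, F z ∈ V := fun z hz => Submodule.subset_span ⟨z, hz, rfl⟩
  let u : V := V.orthogonalProjectionOnto v
  have hu : ∀ x : V, inner ℂ u x = inner ℂ v (x : H) := fun x =>
    Submodule.inner_orthogonalProjectionOnto_eq_of_mem_right x v
  have hu0 : u ≠ 0 := by
    intro h0
    have := hu ⟨F z₀, hFV z₀ hz₀⟩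
    rw [h0, inner_zero_left, hv z₀ hz₀] at this
    exact zero_ne_one this
  have hnu : ‖u‖ ≠ 0 := norm_ne_zero_iff.2 hu0
  have hnu' : ‖(u : H)‖ ≠ 0 := hnu
  obtain ⟨m, hm⟩ : ∃ m, finrank ℂ V = m + 1 := by
    have : Nontrivial V := ⟨u, 0, hu0⟩
    exact Nat.exists_eq_succ_of_ne_zero finrank_pos.ne'
  -- The coordinate of `F z` along `u / ‖u‖` is the constant `1 / ‖u‖`. Scaling all coordinates by
  -- `‖u‖` turns it into `1`, which yields `κ = ‖u‖²`.
  obtain ⟨b, hb⟩ := Orthonormal.exists_orthonormalBasis_extension_of_card_eq (𝕜 := ℂ)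
    (ι := Fin (m + 1)) (by simpa using hm) (v := fun _ => ((‖u‖⁻¹ : ℝ) : ℂ) • u) (s := {0})
    (by
      constructor
      · rintro ⟨i, hi⟩
        simp [norm_smul, hnu']
      · rintro ⟨i, hi⟩ ⟨j, hj⟩ hij
        exact absurd (Subtype.ext (hi.trans hj.symm)) hij)
  have hb0 : b 0 = ((‖u‖⁻¹ : ℝ) : ℂ) • u := hb 0 rfl
  let T : H →L[ℂ] EuclideanSpace ℂ (Fin m) :=
    (EuclideanSpace.equiv (Fin m) ℂ).symm.toContinuousLinearMap.comp
      (ContinuousLinearMap.pi fun i => (‖u‖ : ℂ) • innerSL ℂ ((b i.succ : V) : H))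
  have hT : ∀ (x : H) (i : Fin m), T x i = ‖u‖ * inner ℂ ((b i.succ : V) : H) x :=
    fun x i => rfl
  have hhom : ∀ z (hz : z ∈ Ω), homVec (T (F z)) = (‖u‖ : ℂ) • b.repr ⟨F z, hFV z hz⟩ := by
    intro z hz
    ext i
    refine Fin.cases ?_ (fun i => ?_) i
    · have h1 := hu ⟨F z, hFV z hz⟩
      rw [hv z hz] at h1
      simp [b.repr_apply_apply, hb0, inner_smul_left, h1, hnu']
    · simp [b.repr_apply_apply, hT]
  refine ⟨m, T, ‖u‖ ^ 2, hm, by positivity, fun z hz => ?_, ?_, ?_⟩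
  · rw [← norm_homVec_sq, hhom z hz, norm_smul, mul_pow]
    simp
  · rw [isMinimallyEmbedded_iff_span_homVec]
    set S := Submodule.span ℂ ((fun z => homVec (T (F z))) '' Ω) with hS
    have h1 : V ≤ (S.comap b.repr.toLinearEquiv.toLinearMap).map V.subtype := by
      conv_lhs => rw [hV]
      rw [Submodule.span_le]
      rintro _ ⟨z, hz, rfl⟩
      refine ⟨⟨F z, hFV z hz⟩, ?_, rfl⟩
      have h2 : homVec (T (F z)) ∈ S := Submodule.subset_span ⟨z, hz, rfl⟩
      rw [hhom z hz] at h2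
      exact (S.smul_mem_iff (by exact_mod_cast hnu)).1 h2
    rw [eq_top_iff]
    intro y _
    obtain ⟨x, hx, hxy⟩ := h1 (b.repr.symm y).2
    have h3 : x = b.repr.symm y := Subtype.ext hxy
    have h4 : b.repr x ∈ S := hx
    rwa [h3, LinearIsometryEquiv.apply_symm_apply] at h4
  -- The remaining basis vectors lie in `V`, so they see this vector only through `u`, a multiple of
  -- `b 0`.
  · rintro ⟨z, hz, rfl⟩
    ext i
    rw [hT, ← inner_conj_symm, ← hu]
    have h1 : u = (‖u‖ : ℂ) • b 0 := by
      rw [hb0, smul_smul]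
      simp [hnu']
    rw [h1, inner_smul_left, b.inner_eq_zero (Fin.succ_ne_zero i).symm]
    simp

variable {n d : ℕ}

/-- The Segre product of the homogeneous coordinates of two points. -/
noncomputable def segre (w : EuclideanSpace ℂ (Fin n)) (y : EuclideanSpace ℂ (Fin d)) :
    EuclideanSpace ℂ (Fin (n + 1) × Fin (d + 1)) :=
  WithLp.toLp 2 fun ij => homVec w ij.1 * homVec y ij.2

@[simp]
theorem segre_apply (w : EuclideanSpace ℂ (Fin n)) (y : EuclideanSpace ℂ (Fin d))
    (ij : Fin (n + 1) × Fin (d + 1)) : segre w y ij = homVec w ij.1 * homVec y ij.2 := rfl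

/-- Taking logarithms, the potentials of the two factors add; this is why the Segre product realizes
the sum of the forms. -/
theorem norm_segre_sq (w : EuclideanSpace ℂ (Fin n)) (y : EuclideanSpace ℂ (Fin d)) :
    ‖segre w y‖ ^ 2 = (1 + ‖w‖ ^ 2) * (1 + ‖y‖ ^ 2) := by
  rw [← norm_homVec_sq, ← norm_homVec_sq, EuclideanSpace.norm_sq_eq, EuclideanSpace.norm_sq_eq,
    EuclideanSpace.norm_sq_eq, Fintype.sum_prod_type, Finset.sum_mul_sum]
  simp [mul_pow]

theorem differentiableOn_segre {Ω : Set (EuclideanSpace ℂ (Fin n))}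
    {f : EuclideanSpace ℂ (Fin n) → EuclideanSpace ℂ (Fin d)} (hf : DifferentiableOn ℂ f Ω) :
    DifferentiableOn ℂ (fun z => segre z (f z)) Ω := by
  rw [differentiableOn_euclidean]
  intro ij
  have h1 := differentiableOn_euclidean.1 ((differentiable_homVec (N := n)).differentiableOn (s := Ω)) ij.1
  have h2 := differentiableOn_euclidean.1 (differentiable_homVec.comp_differentiableOn hf) ij.2
  exact h1.mul h2

/-- Evaluation of linear functionals along a mapping. -/
def pullbackDual {X V : Type*} [AddCommGroup V] [Module ℂ V] (F : X → V) :
    Dual ℂ V →ₗ[ℂ] (X → ℂ) where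
  toFun φ x := φ (F x)
  map_add' _ _ := rfl
  map_smul' _ _ := rfl

/-- The components of a mapping span a space of the same dimension as its values. -/
theorem finrank_range_pullbackDual {X V : Type*} [AddCommGroup V] [Module ℂ V]
    [FiniteDimensional ℂ V] (F : X → V) :
    finrank ℂ (LinearMap.range (pullbackDual F)) =
      finrank ℂ (Submodule.span ℂ (Set.range F)) := by
  have hker : LinearMap.ker (pullbackDual F) =
      (Submodule.span ℂ (Set.range F)).dualAnnihilator := by
    ext φ
    rw [LinearMap.mem_ker, Submodule.mem_dualAnnihilator]
    constructor
    · intro h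
      have : Submodule.span ℂ (Set.range F) ≤ LinearMap.ker φ := by
        rw [Submodule.span_le]
        rintro _ ⟨x, rfl⟩
        exact congrFun h x
      exact fun w hw => this hw
    · intro h
      funext x
      exact h _ (Submodule.subset_span ⟨x, rfl⟩)
  have h1 := LinearMap.finrank_range_add_finrank_ker (pullbackDual F)
  have h2 := Subspace.finrank_add_finrank_dualAnnihilator_eq (Submodule.span ℂ (Set.range F))
  rw [hker, Subspace.dual_finrank_eq] at h1
  omega

/-- The product is the functional `α ⊗ β` evaluated on the Segre vector: `R` contracts the second
index with `β`, and `α` is then applied. -/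
theorem mul_mem_range_pullbackDual_segre {X : Type*} (w : X → EuclideanSpace ℂ (Fin n))
    (y : X → EuclideanSpace ℂ (Fin d)) (α : Dual ℂ (EuclideanSpace ℂ (Fin (n + 1))))
    (β : Dual ℂ (EuclideanSpace ℂ (Fin (d + 1)))) :
    (fun x => α (homVec (w x)) * β (homVec (y x))) ∈
      LinearMap.range (pullbackDual fun x => segre (w x) (y x)) := by
  let R : EuclideanSpace ℂ (Fin (n + 1) × Fin (d + 1)) →ₗ[ℂ] EuclideanSpace ℂ (Fin (n + 1)) :=
    { toFun := fun x => WithLp.toLp 2 fun i => β (WithLp.toLp 2 fun j => x (i, j))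
      map_add' := fun x x' => by
        ext i
        exact β.map_add (WithLp.toLp 2 fun j => x (i, j)) (WithLp.toLp 2 fun j => x' (i, j))
      map_smul' := fun c x => by
        ext i
        exact β.map_smul c (WithLp.toLp 2 fun j => x (i, j)) }
  have hR : ∀ w y, R (segre w y) = β (homVec y) • homVec w := by
    intro w y
    ext i
    have := β.map_smul (homVec w i) (homVec y)
    rw [smul_eq_mul, mul_comm] at this
    exact this
  refine ⟨α.comp R, ?_⟩
  funext x
  change α (R (segre (w x) (y x))) = _
  rw [hR, map_smul, smul_eq_mul, mul_comm]

/-- The bounds for the dimension of the span of the Segre product of a point with its image. -/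
theorem finrank_span_segre_bounds {Ω : Set (EuclideanSpace ℂ (Fin n))} (hΩ : IsOpen Ω)
    {f : EuclideanSpace ℂ (Fin n) → EuclideanSpace ℂ (Fin d)} (hf : ContinuousOn f Ω)
    (hmin : IsMinimallyEmbedded Ω f) {M : ℕ}
    (hM : finrank ℂ (Submodule.span ℂ ((fun z => segre z (f z)) '' Ω)) = M) :
    M ≤ (n + 1) * (d + 1) ∧ d + 1 ≤ M ∧
      ∀ k ≤ d, k ≤ n → 2 * ((n + 1) * (k + 1)) ≤ 2 * M + k * (k + 1) := by
  set F : Ω → EuclideanSpace ℂ (Fin (n + 1) × Fin (d + 1)) := fun z => segre z (f z)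
  set W := LinearMap.range (pullbackDual F) with hW
  set B := LinearMap.range (pullbackDual fun z : Ω => homVec (f z)) with hB
  have hWM : finrank ℂ W = M := by
    rw [hW, finrank_range_pullbackDual, ← hM, Set.image_eq_range]
  have hBd : finrank ℂ B = d + 1 := by
    rw [isMinimallyEmbedded_iff_span_homVec, Set.image_eq_range] at hmin
    rw [hB, finrank_range_pullbackDual, hmin, finrank_top, finrank_euclideanSpace_fin]
  -- The coordinate that is constantly `1`, so that multiplying by it embeds `B` in `W`.
  let π₀ : Dual ℂ (EuclideanSpace ℂ (Fin (n + 1))) := (EuclideanSpace.proj (𝕜 := ℂ) 0).toLinearMap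
  have hBW : B ≤ W := by
    rintro _ ⟨β, rfl⟩
    convert mul_mem_range_pullbackDual_segre (fun z : Ω => (z : EuclideanSpace ℂ (Fin n)))
      (fun z : Ω => f z) π₀ β using 1
    funext z
    simp [π₀, pullbackDual]
  have hcont : ∀ b ∈ B, Continuous b := by
    rintro _ ⟨β, rfl⟩
    exact (LinearMap.continuous_of_finiteDimensional β).comp
      (differentiable_homVec.continuous.comp (continuousOn_iff_continuous_domRestrict.1 hf))
  have hmul : ∀ φ : EuclideanSpace ℂ (Fin n) →ₗ[ℂ] ℂ, ∀ b ∈ B,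
      (fun x : Ω => φ x * b x) ∈ W := by
    rintro φ _ ⟨β, rfl⟩
    let tail : EuclideanSpace ℂ (Fin (n + 1)) →ₗ[ℂ] EuclideanSpace ℂ (Fin n) :=
      { toFun := fun x => WithLp.toLp 2 fun i => x i.succ
        map_add' := fun x y => rfl
        map_smul' := fun c x => rfl }
    exact mul_mem_range_pullbackDual_segre (fun z : Ω => (z : EuclideanSpace ℂ (Fin n)))
      (fun z : Ω => f z) (φ.comp tail) β
  refine ⟨?_, ?_, fun k hkd hkn => ?_⟩
  · rw [← hM]
    refine (Submodule.finrank_le _).trans ?_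
    simp
  · rw [← hBd, ← hWM]
    exact Submodule.finrank_mono hBW
  -- The affine bound needs a space of dimension at most `n + 1`; passing to a subspace of `B`
  -- covers `d > n`.
  · obtain ⟨B', hB'le, hB'⟩ := exists_submodule_le_finrank_eq B (r := k + 1) (by omega)
    rw [← hWM]
    exact finrank_affine_mul_lower_bound n (by simp) hΩ hkn B' W hB'
      (fun b hb => hcont b (hB'le hb)) (hB'le.trans hBW) fun φ b hb => hmul φ b (hB'le hb)

/-- Mappings whose potentials differ from the potential of `ω_n + f^*ω_d` by a constant realize
that form. -/
theorem realizesModification_of_norm_eq {m : ℕ} {Ω : Set (EuclideanSpace ℂ (Fin n))}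
    (hΩ : IsOpen Ω) {f : EuclideanSpace ℂ (Fin n) → EuclideanSpace ℂ (Fin d)}
    (hf : DifferentiableOn ℂ f Ω) {h : EuclideanSpace ℂ (Fin n) → EuclideanSpace ℂ (Fin m)}
    (hh : DifferentiableOn ℂ h Ω) (hmin : IsMinimallyEmbedded Ω h) {κ : ℝ} (hκ : 0 < κ)
    (hnorm : ∀ z ∈ Ω, 1 + ‖h z‖ ^ 2 = κ * ((1 + ‖z‖ ^ 2) * (1 + ‖f z‖ ^ 2))) :
    RealizesModification Ω f h := by
  refine ⟨hh, hmin, fun z hz => ?_⟩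
  have hid : fubiniStudyForm n z = (Complex.I / (2 * (Real.pi : ℂ))) •
      ddbar (fun z : EuclideanSpace ℂ (Fin n) => (potential id z : ℂ)) z := rfl
  have hsmul : ∀ (c : ℂ) (ω η : EuclideanSpace ℂ (Fin n) [⋀^Fin 2]→L[ℝ] ℂ),
      c • ω + c • η = c • (ω + η) := fun c ω η => by
    ext v
    simp
  rw [hid, pullback_fubiniStudyForm hΩ hf hz, pullback_fubiniStudyForm hΩ hh hz, hsmul,
    ← ddbar_add (contDiffAt_ofReal_potential hΩ differentiableOn_id hz)
      (contDiffAt_ofReal_potential hΩ hf hz), ← ddbar_add_const _ ((Real.log κ : ℝ) : ℂ)]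
  congr 1
  refine Filter.EventuallyEq.ddbar_eq ?_
  filter_upwards [hΩ.mem_nhds hz] with x hx
  have h1 : (1 : ℝ) + ‖x‖ ^ 2 ≠ 0 := by positivity
  have h2 : (1 : ℝ) + ‖f x‖ ^ 2 ≠ 0 := by positivity
  have h3 : potential h x = potential id x + potential f x + Real.log κ := by
    simp only [potential, id]
    rw [hnorm x hx, Real.log_mul hκ.ne' (mul_ne_zero h1 h2), Real.log_mul h1 h2]
    ring
  rw [h3]
  push_cast
  rfl

end Existence

end FubiniStudy

/-! ### The main theorem. -/

theorem theorem1 {n d : ℕ} (Ω : Set (EuclideanSpace ℂ (Fin n)))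
    (hΩ_open : IsOpen Ω) (hΩ_conn : IsConnected Ω)
    (f : EuclideanSpace ℂ (Fin n) → EuclideanSpace ℂ (Fin d))
    (hf : DifferentiableOn ℂ f Ω) (hf_min : FubiniStudy.IsMinimallyEmbedded Ω f) :
    ∃ m : ℕ,
      -- existence, with `h(0) = 0` in the normalized situation `f(0) = 0`
      (∃ h : EuclideanSpace ℂ (Fin n) → EuclideanSpace ℂ (Fin m),
        FubiniStudy.RealizesModification Ω f h ∧
          ((0 : EuclideanSpace ℂ (Fin n)) ∈ Ω → f 0 = 0 → h 0 = 0)) ∧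
      -- the dimension is unique
      (∀ (m' : ℕ) (h' : EuclideanSpace ℂ (Fin n) → EuclideanSpace ℂ (Fin m')),
        FubiniStudy.RealizesModification Ω f h' → m' = m) ∧
      -- uniqueness up to a unitary transformation of projective space, and up to a unitary
      -- `m × m` matrix for mappings normalized to vanish at a common point
      (∀ h h' : EuclideanSpace ℂ (Fin n) → EuclideanSpace ℂ (Fin m),
        FubiniStudy.RealizesModification Ω f h → FubiniStudy.RealizesModification Ω f h' →
          (∃ U ∈ Matrix.unitaryGroup (Fin (m + 1)) ℂ, ∀ z ∈ Ω, ∃ c : ℂ, c ≠ 0 ∧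
            FubiniStudy.homogeneousCoords (h' z) =
              c • (U *ᵥ FubiniStudy.homogeneousCoords (h z))) ∧
          ((∃ p ∈ Ω, h p = 0 ∧ h' p = 0) →
            ∃ U ∈ Matrix.unitaryGroup (Fin m) ℂ, ∀ z ∈ Ω,
              h' z = WithLp.toLp 2 (U *ᵥ WithLp.ofLp (h z)))) ∧
      -- the range of the dimension
      (d ≤ n →
        (n : ℝ) * (d + 1) - (d : ℝ) * ((d : ℝ) - 1) / 2 ≤ (m : ℝ) ∧
          (m : ℝ) ≤ (n : ℝ) * (d + 1) + d) ∧
      (n ≤ d → max ((n : ℝ) * (n + 3) / 2) (d : ℝ) ≤ (m : ℝ)) := by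
  have hone : ∀ z ∈ Ω, inner ℂ
      (EuclideanSpace.single ((0, 0) : Fin (n + 1) × Fin (d + 1)) (1 : ℂ))
      (FubiniStudy.segre z (f z)) = 1 := fun z _ => by
    simp [EuclideanSpace.inner_single_left]
  obtain ⟨m, T, κ, hm, hκ, hnorm, hmin, hzero⟩ :=
    FubiniStudy.exists_minimal_affine_projection hΩ_conn.nonempty
      (fun z => FubiniStudy.segre z (f z)) _ hone
  obtain ⟨hup, hdm, hlow⟩ :=
    FubiniStudy.finrank_span_segre_bounds hΩ_open hf.continuousOn hf_min hm
  have hreal : FubiniStudy.RealizesModification Ω f fun z => T (FubiniStudy.segre z (f z)) :=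
    FubiniStudy.realizesModification_of_norm_eq hΩ_open hf
      (T.differentiable.comp_differentiableOn (FubiniStudy.differentiableOn_segre hf)) hmin hκ
      fun z hz => by rw [hnorm z hz, FubiniStudy.norm_segre_sq]
  have hrigid : ∀ {k k' : ℕ} (h : EuclideanSpace ℂ (Fin n) → EuclideanSpace ℂ (Fin k))
      (h' : EuclideanSpace ℂ (Fin n) → EuclideanSpace ℂ (Fin k')),
      FubiniStudy.RealizesModification Ω f h → FubiniStudy.RealizesModification Ω f h' →
      ∃ e : EuclideanSpace ℂ (Fin (k + 1)) ≃ₗᵢ[ℂ] EuclideanSpace ℂ (Fin (k' + 1)),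
        ∀ z ∈ Ω, ∃ c : ℂ, c ≠ 0 ∧
          e (FubiniStudy.homVec (h z)) = c • FubiniStudy.homVec (h' z) :=
    fun h h' hh hh' => FubiniStudy.exists_isometry_of_pullback_eq hΩ_open hΩ_conn hh.holomorphic
      hh'.holomorphic hh.minimallyEmbedded hh'.minimallyEmbedded
      fun z hz => (hh.isometric z hz).symm.trans (hh'.isometric z hz)
  refine ⟨m, ⟨_, hreal, fun h0 hf0 => ?_⟩, fun m' h' hh' => ?_, fun h h' hh hh' => ⟨?_, ?_⟩,
    fun hdn => ⟨?_, ?_⟩, fun hnd => max_le ?_ ?_⟩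
  -- In the normalized situation the Segre vector at `0` is the coordinate vector itself, which `T`
  -- sends to `0`.
  · have hs : FubiniStudy.segre (0 : EuclideanSpace ℂ (Fin n)) (f 0) =
        EuclideanSpace.single (0, 0) 1 := by
      rw [hf0]
      ext ⟨i, j⟩
      induction i using Fin.cases <;> induction j using Fin.cases <;> simp
    change T (FubiniStudy.segre (0 : EuclideanSpace ℂ (Fin n)) (f 0)) = 0
    rw [hs]
    exact hzero ⟨0, h0, hs⟩
  · obtain ⟨e, -⟩ := hrigid _ _ hh' hreal
    have := e.toLinearEquiv.finrank_eq
    simpa using this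
  · obtain ⟨e, he⟩ := hrigid h h' hh hh'
    obtain ⟨U, hU, hUe⟩ := FubiniStudy.exists_mem_unitaryGroup e
    refine ⟨U, hU, fun z hz => ?_⟩
    obtain ⟨c, hc, hce⟩ := he z hz
    refine ⟨c⁻¹, inv_ne_zero hc, ?_⟩
    have h1 := hUe (FubiniStudy.homVec (h z))
    rw [hce, WithLp.ofLp_smul] at h1
    change c • FubiniStudy.homogeneousCoords (h' z) =
      U *ᵥ FubiniStudy.homogeneousCoords (h z) at h1
    rw [← h1, smul_smul, inv_mul_cancel₀ hc, one_smul]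
  · rintro ⟨p, hp, hhp, hhp'⟩
    obtain ⟨e, he⟩ := hrigid h h' hh hh'
    obtain ⟨e', he'⟩ := FubiniStudy.exists_linearIsometryEquiv_of_gram_eq
      (u := fun z : Ω => h z) (v := fun z : Ω => h' z)
      (by rw [← Set.image_eq_range]; exact hh.minimallyEmbedded.span_image_eq_top)
      (by rw [← Set.image_eq_range]; exact hh'.minimallyEmbedded.span_image_eq_top)
      fun w z => FubiniStudy.inner_eq_inner_of_common_zero e he hp hhp hhp' w.2 z.2
    obtain ⟨U, hU, hUe⟩ := FubiniStudy.exists_mem_unitaryGroup e'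
    refine ⟨U, hU, fun z hz => ?_⟩
    rw [← hUe (h z), he' ⟨z, hz⟩]
  -- The span has dimension `m + 1`; the full space `B`, `k = d`, gives the lower bound of (i).
  · have h1 : (2 * ((n + 1) * (d + 1)) : ℝ) ≤ 2 * (m + 1) + d * (d + 1) := by
      exact_mod_cast hlow d le_rfl hdn
    linarith
  · have h1 : ((m : ℝ) + 1) ≤ (n + 1) * (d + 1) := by exact_mod_cast hup
    linarith
  -- For `d ≥ n` the largest admissible choice is `k = n`.
  · have h1 : (2 * ((n + 1) * (n + 1)) : ℝ) ≤ 2 * (m + 1) + n * (n + 1) := by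
      exact_mod_cast hlow n hnd le_rfl
    linarith
  · exact_mod_cast Nat.le_of_succ_le_succ hdm
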